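/- Let $k$ be a field. A quasi-coherent sheaf on the projective line $\mathbf{P}^1(k)$ is identified with a representation $M\xrightarrow{f}P\xleftarrow{g}N$, where $M$, $P$, $N$ are modules over $k[x]$, $k[x,x^{-1}]$, $k[x^{-1}]$ respectively, $f$ is $k[x]$-linear, $g$ is $k[x^{-1}]$-linear, $f$ is a localization at the powers of $x$ and $g$ is a localization at the powers of $x^{-1}$. Let $\mathfrak{Qco}(\mathbf{P}^1(k))$ be the abelian category of these sheaves and $\mathrm{Ch}(\mathfrak{Qco}(\mathbf{P}^1(k)))$ the category of unbounded complexes in it. For $n\in\mathbb{Z}$ let $\mathcal{O}(n)$ be the sheaf $k[x]\to k[x,x^{-1}]\leftarrow k[x^{-1}]$ whose first map is the inclusion and whose second map is $q\mapsto x^nq$. In an abelian category, for a class $\mathcal{D}$ of objects let $\mathcal{D}^{\perp}$ be the class of all $Y$ with $\mathrm{Ext}^1(D,Y)=0$ for all $D\in\mathcal{D}$, and ${}^{\perp}\mathcal{D}$ the class of all $Z$ with $\mathrm{Ext}^1(Z,D)=0$ for all $D\in\mathcal{D}$; here $\mathrm{Ext}^1$ is the group of equivalence classes of short exact sequences. A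 pair $(\mathcal{F},\mathcal{C})$ of classes is a cotorsion pair if $\mathcal{F}^{\perp}=\mathcal{C}$ and ${}^{\perp}\mathcal{C}=\mathcal{F}$. It is complete if moreover for every object $Z$ there are short exact sequences $0\to Z\to C\to F\to 0$ and $0\to C'\to F'\to Z\to 0$ with $F,F'\in\mathcal{F}$ and $C,C'\in\mathcal{C}$. It is cogenerated by a set if $\mathcal{C}=T^{\perp}$ for some (small) set $T$ of objects of $\mathcal{F}$. Let $\mathcal{P}$ be the class of locally projective quasi-coherent sheaves on $\mathbf{P}^1(k)$, i.e. of those $M\to P\leftarrow N$ for which $M$, $P$, $N$ are projective modules over $k[x]$, $k[x,x^{-1}]$, $k[x^{-1}]$, and let $\mathcal{U}^{\perp}$ be the right orthogonal class of $\mathcal{U}=\{\mathcal{O}(n):n\in\mathbb{Z}\}$. Let $\widetilde{\mathcal{P}}$ be the class of exact complexes $E$ such that the cycles $Z_nE$ lie in $\mathcal{P}$ for all $n\in\mathbb{Z}$. Let $dg\widetilde{\mathcal{U}^{\perp}}$ be the class of complexes $Y$ such that $Y^n\in\mathcal{U}^{\perp}$ for all $n\in\mathbb{Z}$ and the complex of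 abelian groups $\mathrm{Hom}(E,Y)$, with terms $\prod_{i}\mathrm{Hom}(E^i,Y^{i+n})$, is exact for every $E\in\widetilde{\mathcal{P}}$. **Theorem.** $(\widetilde{\mathcal{P}},dg\widetilde{\mathcal{U}^{\perp}})$ is a complete cotorsion pair in $\mathrm{Ch}(\mathfrak{Qco}(\mathbf{P}^1(k)))$, and it is cogenerated by a set. -/

import Mathlib

universe u

section CotorsionPairs

open CategoryTheory CategoryTheory.Limits

namespace CotorsionTheory

universe v w

variable {A : Type w} [Category.{v} A] [Abelian A]

/-- `Ext¹(D, Y) = 0` for the Yoneda `Ext¹`, whose elements are the equivalence classes of short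
exact sequences `0 ⟶ Y ⟶ E ⟶ D ⟶ 0` and whose zero is the class of the split ones. -/
def ExtOneVanishes (D Y : A) : Prop :=
  ∀ (E : A) (i : Y ⟶ E) (p : E ⟶ D) (w : i ≫ p = 0),
    (ShortComplex.mk i p w).ShortExact → Nonempty (ShortComplex.mk i p w).Splitting

/-- The class `𝒟^⊥`. -/
def rightPerp (𝒟 : ObjectProperty A) : ObjectProperty A :=
  fun Y => ∀ D, 𝒟 D → ExtOneVanishes D Y

/-- The class `^⊥𝒟`. -/
def leftPerp (𝒟 : ObjectProperty A) : ObjectProperty A :=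
  fun Z => ∀ D, 𝒟 D → ExtOneVanishes Z D

structure IsCotorsionPair (ℱ 𝒞 : ObjectProperty A) : Prop where
  rightPerp_eq : rightPerp ℱ = 𝒞
  leftPerp_eq : leftPerp 𝒞 = ℱ

def HasEnoughInjectives (ℱ 𝒞 : ObjectProperty A) : Prop :=
  ∀ Z : A, ∃ (C F : A) (i : Z ⟶ C) (p : C ⟶ F) (w : i ≫ p = 0),
    (ShortComplex.mk i p w).ShortExact ∧ 𝒞 C ∧ ℱ F

def HasEnoughProjectives (ℱ 𝒞 : ObjectProperty A) : Prop :=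
  ∀ Z : A, ∃ (C F : A) (i : C ⟶ F) (p : F ⟶ Z) (w : i ≫ p = 0),
    (ShortComplex.mk i p w).ShortExact ∧ 𝒞 C ∧ ℱ F

structure IsCompleteCotorsionPair (ℱ 𝒞 : ObjectProperty A) : Prop
    extends IsCotorsionPair ℱ 𝒞 where
  enoughInjectives : HasEnoughInjectives ℱ 𝒞
  enoughProjectives : HasEnoughProjectives ℱ 𝒞

/-- `(ℱ, 𝒞)` is cogenerated by a (small) set: there is a family of objects of `ℱ`, indexed by a
type in the universe `u`, whose right orthogonal class is `𝒞`. -/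
def IsCogeneratedBySet (ℱ 𝒞 : ObjectProperty A) : Prop :=
  ∃ (I : Type u) (T : I → A), (∀ i, ℱ (T i)) ∧ rightPerp (ObjectProperty.ofObj T) = 𝒞

/-- The exact complexes with all cycles in `ℱ`. -/
def exactWithCyclesIn (ℱ : ObjectProperty A) : ObjectProperty (CochainComplex A ℤ) :=
  fun E => E.Acyclic ∧ ∀ n : ℤ, ℱ (E.cycles n)

/-- For a cotorsion pair `(ℱ, 𝒞)`, the `dg-𝒞` complexes: the complexes `Y` with terms in `𝒞` such
that the complex of abelian groups `Hom(E, Y)` is exact for every exact complex `E` with cycles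
in `ℱ`. -/
def dgRight (ℱ 𝒞 : ObjectProperty A) : ObjectProperty (CochainComplex A ℤ) :=
  fun Y => (∀ n : ℤ, 𝒞 (Y.X n)) ∧
    ∀ E : CochainComplex A ℤ, exactWithCyclesIn ℱ E → (CochainComplex.HomComplex E Y).Acyclic

end CotorsionTheory

end CotorsionPairs

section ProjectiveLine

open CategoryTheory CategoryTheory.Limits Opposite ZeroObject
open scoped Polynomial LaurentPolynomial

namespace ProjLine

noncomputable section

variable (k : Type u) [Field k]

/-- The inclusion `k[x] → k[x, x⁻¹]`. -/
abbrev ιU : k[X] →+* k[T;T⁻¹] := Polynomial.toLaurent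

/-- The inclusion `k[x⁻¹] → k[x, x⁻¹]`, where `k[x⁻¹]` is the polynomial ring in a variable that
is sent to `x⁻¹`. -/
abbrev ιV : k[X] →+* k[T;T⁻¹] :=
  (LaurentPolynomial.invert (R := k) : k[T;T⁻¹] →+* k[T;T⁻¹]).comp Polynomial.toLaurent

lemma ιV_X : ιV k Polynomial.X = LaurentPolynomial.T (-1) := by
  simp [ιV]

/-- The diagram of rings `k[x] → k[x, x⁻¹] ← k[x⁻¹]`: the values of the structure sheaf of the
projective line on the standard affine opens `U`, `V` and on `U ∩ V`. -/
def structureRings : WalkingSpanᵒᵖ ⥤ RingCat.{u} :=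
  walkingSpanOpEquiv.functor ⋙ cospan (RingCat.ofHom (ιU k)) (RingCat.ofHom (ιV k))

/-- Representations `M → P ← N`, with `M`, `P`, `N` modules over `k[x]`, `k[x, x⁻¹]`, `k[x⁻¹]`
and with `k[x]`-linear and `k[x⁻¹]`-linear maps. -/
abbrev Rep : Type (u + 1) := PresheafOfModules.{u} (structureRings k)

variable {k}

namespace Rep

/-- The module `M` of `M → P ← N`. -/
def onU (F : Rep k) : ModuleCat.{u} k[X] := F.obj (op WalkingSpan.left)

/-- The module `N` of `M → P ← N`, over `k[x⁻¹]`. -/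
def onV (F : Rep k) : ModuleCat.{u} k[X] := F.obj (op WalkingSpan.right)

/-- The module `P` of `M → P ← N`. -/
def onUV (F : Rep k) : ModuleCat.{u} k[T;T⁻¹] := F.obj (op WalkingSpan.zero)

/-- The map `M → P` of `M → P ← N`. -/
def resU (F : Rep k) : F.onU ⟶ (ModuleCat.restrictScalars (ιU k)).obj F.onUV :=
  F.map WalkingSpan.Hom.fst.op

/-- The map `N → P` of `M → P ← N`. -/
def resV (F : Rep k) : F.onV ⟶ (ModuleCat.restrictScalars (ιV k)).obj F.onUV :=
  F.map WalkingSpan.Hom.snd.op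

/-- `M → P ← N` is quasi-coherent if `M → P` is a localization at the powers of `x` and `N → P` is
a localization at the powers of `x⁻¹`. -/
def IsQuasicoherent : ObjectProperty (Rep k) := fun F =>
  IsLocalizedModule (Submonoid.powers (Polynomial.X : k[X])) F.resU.hom ∧
  IsLocalizedModule (Submonoid.powers (Polynomial.X : k[X])) F.resV.hom

end Rep

section mk

variable (M N : ModuleCat.{u} k[X]) (P : ModuleCat.{u} k[T;T⁻¹])
  (f : M ⟶ (ModuleCat.restrictScalars (ιU k)).obj P)
  (g : N ⟶ (ModuleCat.restrictScalars (ιV k)).obj P)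

def Rep.mkObj : (X : WalkingSpanᵒᵖ) → ModuleCat.{u} ((structureRings k).obj X)
  | op none => P
  | op (some WalkingPair.left) => M
  | op (some WalkingPair.right) => N

def Rep.mkMap : {X Y : WalkingSpan} → (h : Y ⟶ X) →
    (Rep.mkObj M N P (op X) ⟶ (ModuleCat.restrictScalars ((structureRings k).map h.op).hom).obj
      (Rep.mkObj M N P (op Y)))
  | _, _, WidePushoutShape.Hom.id X =>
      (ModuleCat.restrictScalarsId' ((structureRings k).map (𝟙 (op X))).hom
        (congrArg RingCat.Hom.hom ((structureRings k).map_id (op X)))).inv.app _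
  | _, _, WidePushoutShape.Hom.init WalkingPair.left => f
  | _, _, WidePushoutShape.Hom.init WalkingPair.right => g

/-- The representation `M → P ← N` with the given modules and maps. -/
def Rep.mk : Rep k where
  obj := Rep.mkObj M N P
  map h := Rep.mkMap M N P f g h.unop
  map_id X := rfl
  map_comp {X Y Z} a b := by
    obtain ⟨X⟩ := X
    obtain ⟨Y⟩ := Y
    obtain ⟨Z⟩ := Z
    obtain ⟨a, rfl⟩ : ∃ a' : Y ⟶ X, a'.op = a := ⟨a.unop, rfl⟩
    obtain ⟨b, rfl⟩ : ∃ b' : Z ⟶ Y, b'.op = b := ⟨b.unop, rfl⟩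
    rcases b with _ | (_ | _) <;> rcases a with _ | (_ | _) <;> rfl
end mk

section loc
variable {R : Type*} [CommRing R] (x : R)

lemma isLocalizedModule_powers_iff {M P : Type*} [AddCommGroup M] [AddCommGroup P] [Module R M]
    [Module R P] (f : M →ₗ[R] P) (hx : IsUnit (algebraMap R (Module.End R P) x)) :
    IsLocalizedModule (Submonoid.powers x) f ↔
      (∀ p, ∃ n : ℕ, ∃ m, x ^ n • p = f m) ∧ (∀ m, f m = 0 → ∃ n : ℕ, x ^ n • m = 0) := by
  constructor
  · intro h
    refine ⟨fun p => ?_, fun m hm => ?_⟩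
    · obtain ⟨⟨m, ⟨_, n, rfl⟩⟩, hm⟩ := IsLocalizedModule.surj (Submonoid.powers x) f p
      exact ⟨n, m, hm⟩
    · obtain ⟨⟨_, n, rfl⟩, hn⟩ := IsLocalizedModule.exists_of_eq (S := Submonoid.powers x)
        (f := f) (x₁ := m) (x₂ := 0) (by simpa using hm)
      exact ⟨n, by simpa [Submonoid.smul_def] using hn⟩
  · rintro ⟨h1, h2⟩
    refine ⟨?_, fun p => ?_, fun {a b} hab => ?_⟩
    · rintro ⟨_, n, rfl⟩
      simpa using hx.pow n
    · obtain ⟨n, m, hm⟩ := h1 p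
      exact ⟨⟨m, ⟨_, n, rfl⟩⟩, hm⟩
    · obtain ⟨n, hn⟩ := h2 (a - b) (by simp [hab])
      refine ⟨⟨_, n, rfl⟩, ?_⟩
      simpa [Submonoid.smul_def, smul_sub, sub_eq_zero] using hn

variable {A B C A' B' C' : Type*} [AddCommGroup A] [AddCommGroup B] [AddCommGroup C]
  [AddCommGroup A'] [AddCommGroup B'] [AddCommGroup C'] [Module R A] [Module R B] [Module R C]
  [Module R A'] [Module R B'] [Module R C']
  (rA : A →ₗ[R] A') (rB : B →ₗ[R] B') (rC : C →ₗ[R] C')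

lemma isLocalizedModule_of_kernel (hA : IsUnit (algebraMap R (Module.End R A') x))
    (i : A →ₗ[R] B) (f : B →ₗ[R] C) (i' : A' →ₗ[R] B') (f' : B' →ₗ[R] C')
    (hi : Function.Injective i) (hi' : Function.Injective i')
    (he : Function.Exact i f) (he' : Function.Exact i' f')
    (ci : ∀ a, i' (rA a) = rB (i a)) (cf : ∀ b, f' (rB b) = rC (f b))
    (hB : IsLocalizedModule (Submonoid.powers x) rB)
    (hC : IsLocalizedModule (Submonoid.powers x) rC) :
    IsLocalizedModule (Submonoid.powers x) rA := by
  have uB := IsLocalizedModule.map_units (S := Submonoid.powers x) rB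
    ⟨x, Submonoid.mem_powers x⟩
  have uC := IsLocalizedModule.map_units (S := Submonoid.powers x) rC
    ⟨x, Submonoid.mem_powers x⟩
  rw [isLocalizedModule_powers_iff x _ hA]
  obtain ⟨sB, tB⟩ := (isLocalizedModule_powers_iff x _ uB).1 hB
  obtain ⟨-, tC⟩ := (isLocalizedModule_powers_iff x _ uC).1 hC
  refine ⟨fun p => ?_, fun m hm => ?_⟩
  · obtain ⟨n, b, hb⟩ := sB (i' p)
    obtain ⟨j, hj⟩ := tC (f b) (by
      rw [← cf, ← hb, map_smul, (he' (i' p)).2 ⟨p, rfl⟩, smul_zero])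
    obtain ⟨a, ha⟩ := (he (x ^ j • b)).1 (by rw [map_smul, hj])
    refine ⟨j + n, a, hi' ?_⟩
    rw [ci, ha, map_smul, map_smul, ← hb, pow_add, mul_smul]
  · obtain ⟨n, hn⟩ := tB (i m) (by rw [← ci, hm, map_zero])
    exact ⟨n, hi (by rw [map_smul, hn, map_zero])⟩

lemma isLocalizedModule_of_cokernel (hC : IsUnit (algebraMap R (Module.End R C') x))
    (f : A →ₗ[R] B) (p : B →ₗ[R] C) (f' : A' →ₗ[R] B') (p' : B' →ₗ[R] C')
    (hp : Function.Surjective p) (hp' : Function.Surjective p')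
    (he : Function.Exact f p) (he' : Function.Exact f' p')
    (cf : ∀ a, f' (rA a) = rB (f a)) (cp : ∀ b, p' (rB b) = rC (p b))
    (hA : IsLocalizedModule (Submonoid.powers x) rA)
    (hB : IsLocalizedModule (Submonoid.powers x) rB) :
    IsLocalizedModule (Submonoid.powers x) rC := by
  have uA := IsLocalizedModule.map_units (S := Submonoid.powers x) rA
    ⟨x, Submonoid.mem_powers x⟩
  have uB := IsLocalizedModule.map_units (S := Submonoid.powers x) rB
    ⟨x, Submonoid.mem_powers x⟩
  rw [isLocalizedModule_powers_iff x _ hC]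
  obtain ⟨sA, -⟩ := (isLocalizedModule_powers_iff x _ uA).1 hA
  obtain ⟨sB, tB⟩ := (isLocalizedModule_powers_iff x _ uB).1 hB
  refine ⟨fun c => ?_, fun c hc => ?_⟩
  · obtain ⟨b, rfl⟩ := hp' c
    obtain ⟨n, m, hm⟩ := sB b
    exact ⟨n, p m, by rw [← cp, ← hm, map_smul]⟩
  · obtain ⟨a, rfl⟩ := hp c
    obtain ⟨b, hb⟩ := (he' (rB a)).1 (by rw [cp, hc])
    obtain ⟨n, d, hd⟩ := sA b
    obtain ⟨j, hj⟩ := tB (x ^ n • a - f d) (by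
      rw [map_sub, map_smul, ← cf, ← hd, ← hb, map_smul, sub_self])
    refine ⟨j + n, ?_⟩
    have h0 : p (f d) = 0 := (he (f d)).2 ⟨d, rfl⟩
    have h1 := congrArg p hj
    rwa [map_smul, map_sub, h0, sub_zero, map_smul, map_zero, smul_smul, ← pow_add] at h1

lemma isLocalizedModule_of_sum (hC : IsUnit (algebraMap R (Module.End R C') x))
    (i : A →ₗ[R] C) (j : B →ₗ[R] C) (p : C →ₗ[R] A) (q : C →ₗ[R] B)
    (i' : A' →ₗ[R] C') (j' : B' →ₗ[R] C') (p' : C' →ₗ[R] A') (q' : C' →ₗ[R] B')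
    (h : ∀ c, i (p c) + j (q c) = c) (h' : ∀ c, i' (p' c) + j' (q' c) = c)
    (ci : ∀ a, i' (rA a) = rC (i a)) (cj : ∀ a, j' (rB a) = rC (j a))
    (cp : ∀ a, p' (rC a) = rA (p a)) (cq : ∀ a, q' (rC a) = rB (q a))
    (hA : IsLocalizedModule (Submonoid.powers x) rA)
    (hB : IsLocalizedModule (Submonoid.powers x) rB) :
    IsLocalizedModule (Submonoid.powers x) rC := by
  have uA := IsLocalizedModule.map_units (S := Submonoid.powers x) rA
    ⟨x, Submonoid.mem_powers x⟩
  have uB := IsLocalizedModule.map_units (S := Submonoid.powers x) rB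
    ⟨x, Submonoid.mem_powers x⟩
  rw [isLocalizedModule_powers_iff x _ hC]
  obtain ⟨sA, tA⟩ := (isLocalizedModule_powers_iff x _ uA).1 hA
  obtain ⟨sB, tB⟩ := (isLocalizedModule_powers_iff x _ uB).1 hB
  refine ⟨fun c => ?_, fun c hc => ?_⟩
  · obtain ⟨n, a, ha⟩ := sA (p' c)
    obtain ⟨m, b, hb⟩ := sB (q' c)
    refine ⟨m + n, i (x ^ m • a) + j (x ^ n • b), ?_⟩
    conv_lhs => rw [← h' c]
    rw [map_add, ← ci, ← cj, map_smul rA, map_smul rB, ← ha, ← hb, smul_smul, smul_smul,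
      ← pow_add, ← pow_add, add_comm n m, map_smul, map_smul, ← smul_add]
  · obtain ⟨n, hn⟩ := tA (p c) (by rw [← cp, hc, map_zero])
    obtain ⟨m, hm⟩ := tB (q c) (by rw [← cq, hc, map_zero])
    refine ⟨n + m, ?_⟩
    conv_lhs => rw [← h c]
    have h1 : x ^ (n + m) • i (p c) = 0 := by
      rw [← map_smul, add_comm, pow_add, mul_smul, hn, smul_zero, map_zero]
    have h2 : x ^ (n + m) • j (q c) = 0 := by
      rw [← map_smul, pow_add, mul_smul, hm, smul_zero, map_zero]
    rw [smul_add, h1, h2, add_zero]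

lemma isUnit_restrictScalars {R' : Type u} {S : Type u} [CommRing R'] [CommRing S] (φ : R' →+* S)
    {y : R'} (hy : IsUnit (φ y)) (P : ModuleCat.{u} S) :
    IsUnit (algebraMap R' (Module.End R' ((ModuleCat.restrictScalars φ).obj P)) y) := by
  obtain ⟨v, hv⟩ := hy
  rw [Module.End.isUnit_iff]
  refine Function.bijective_iff_has_inverse.2 ⟨fun p => ((↑v⁻¹ : S) • (p : P) : P), ?_, ?_⟩
  · intro p
    change ((↑v⁻¹ : S) • (φ y • (p : P)) : P) = p
    rw [← hv, smul_smul, Units.inv_mul, one_smul]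
  · intro p
    change (φ y • ((↑v⁻¹ : S) • (p : P)) : P) = p
    rw [← hv, smul_smul, Units.mul_inv, one_smul]

end loc

variable (k) in
lemma isUnit_ιU_X : IsUnit (ιU k Polynomial.X) := by
  simpa [ιU] using LaurentPolynomial.isUnit_T (R := k) 1

variable (k) in
lemma isUnit_ιV_X : IsUnit (ιV k Polynomial.X) := by
  rw [ιV_X]; exact LaurentPolynomial.isUnit_T (-1)

namespace Rep
variable {A B C : Rep k} (f : A ⟶ B)
def appU : A.onU ⟶ B.onU := f.app (op WalkingSpan.left)
def appV : A.onV ⟶ B.onV := f.app (op WalkingSpan.right)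
def appUV : A.onUV ⟶ B.onUV := f.app (op WalkingSpan.zero)
def appUV₁ : (ModuleCat.restrictScalars (ιU k)).obj A.onUV ⟶
  (ModuleCat.restrictScalars (ιU k)).obj B.onUV := (ModuleCat.restrictScalars (ιU k)).map (appUV f)
def appUV₂ : (ModuleCat.restrictScalars (ιV k)).obj A.onUV ⟶
  (ModuleCat.restrictScalars (ιV k)).obj B.onUV := (ModuleCat.restrictScalars (ιV k)).map (appUV f)

lemma natU (a : A.onU) : (appUV₁ f).hom (A.resU.hom a) = B.resU.hom ((appU f).hom a) :=
  congr($(f.naturality WalkingSpan.Hom.fst.op).hom a)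
lemma natV (a : A.onV) : (appUV₂ f).hom (A.resV.hom a) = B.resV.hom ((appV f).hom a) :=
  congr($(f.naturality WalkingSpan.Hom.snd.op).hom a)

lemma exact_app (f : A ⟶ B) (g : B ⟶ C) (w : f ≫ g = 0) (h : (ShortComplex.mk f g w).Exact)
    (X : WalkingSpanᵒᵖ) : Function.Exact (f.app X).hom (g.app X).hom := by
  have := h.map (PresheafOfModules.evaluation (structureRings k) X)
  exact (ShortComplex.ShortExact.moduleCat_exact_iff_function_exact _).1 this

lemma inj_app (f : A ⟶ B) [Mono f] (X : WalkingSpanᵒᵖ) : Function.Injective (f.app X).hom :=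
  (ModuleCat.mono_iff_injective _).1
    (inferInstanceAs (Mono ((PresheafOfModules.evaluation (structureRings k) X).map f)))

lemma surj_app (f : A ⟶ B) [Epi f] (X : WalkingSpanᵒᵖ) : Function.Surjective (f.app X).hom :=
  (ModuleCat.epi_iff_surjective _).1
    (inferInstanceAs (Epi ((PresheafOfModules.evaluation (structureRings k) X).map f)))

lemma isQuasicoherent_of_kernel (f : A ⟶ B) (g : B ⟶ C) (w : f ≫ g = 0) [Mono f]
    (h : (ShortComplex.mk f g w).Exact) (hB : IsQuasicoherent B) (hC : IsQuasicoherent C) :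
    IsQuasicoherent A :=
  ⟨isLocalizedModule_of_kernel _ _ _ _ (isUnit_restrictScalars _ (isUnit_ιU_X k) _)
      (appU f).hom (appU g).hom (appUV₁ f).hom (appUV₁ g).hom (inj_app f _) (inj_app f _)
      (exact_app f g w h _) (exact_app f g w h _) (natU f) (natU g) hB.1 hC.1,
    isLocalizedModule_of_kernel _ _ _ _ (isUnit_restrictScalars _ (isUnit_ιV_X k) _)
      (appV f).hom (appV g).hom (appUV₂ f).hom (appUV₂ g).hom (inj_app f _) (inj_app f _)
      (exact_app f g w h _) (exact_app f g w h _) (natV f) (natV g) hB.2 hC.2⟩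

lemma isQuasicoherent_of_cokernel (f : A ⟶ B) (g : B ⟶ C) (w : f ≫ g = 0) [Epi g]
    (h : (ShortComplex.mk f g w).Exact) (hA : IsQuasicoherent A) (hB : IsQuasicoherent B) :
    IsQuasicoherent C :=
  ⟨isLocalizedModule_of_cokernel _ _ _ _ (isUnit_restrictScalars _ (isUnit_ιU_X k) _)
      (appU f).hom (appU g).hom (appUV₁ f).hom (appUV₁ g).hom (surj_app g _) (surj_app g _)
      (exact_app f g w h _) (exact_app f g w h _) (natU f) (natU g) hA.1 hB.1,
    isLocalizedModule_of_cokernel _ _ _ _ (isUnit_restrictScalars _ (isUnit_ιV_X k) _)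
      (appV f).hom (appV g).hom (appUV₂ f).hom (appUV₂ g).hom (surj_app g _) (surj_app g _)
      (exact_app f g w h _) (exact_app f g w h _) (natV f) (natV g) hA.2 hB.2⟩

lemma isQuasicoherent_of_sum (i : A ⟶ C) (j : B ⟶ C) (p : C ⟶ A) (q : C ⟶ B)
    (h : p ≫ i + q ≫ j = 𝟙 C) (hA : IsQuasicoherent A) (hB : IsQuasicoherent B) :
    IsQuasicoherent C := by
  have key : ∀ X c, (i.app X).hom ((p.app X).hom c) + (j.app X).hom ((q.app X).hom c) = c :=
    fun X c => congr(($h).app X c)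
  exact ⟨isLocalizedModule_of_sum _ _ _ _ (isUnit_restrictScalars _ (isUnit_ιU_X k) _)
      (appU i).hom (appU j).hom (appU p).hom (appU q).hom
      (appUV₁ i).hom (appUV₁ j).hom (appUV₁ p).hom (appUV₁ q).hom
      (key _) (key _) (natU i) (natU j) (natU p) (natU q) hA.1 hB.1,
    isLocalizedModule_of_sum _ _ _ _ (isUnit_restrictScalars _ (isUnit_ιV_X k) _)
      (appV i).hom (appV j).hom (appV p).hom (appV q).hom
      (appUV₂ i).hom (appUV₂ j).hom (appUV₂ p).hom (appUV₂ q).hom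
      (key _) (key _) (natV i) (natV j) (natV p) (natV q) hA.2 hB.2⟩

instance : (IsQuasicoherent (k := k)).IsClosedUnderIsomorphisms where
  of_iso {A B} e hA := isQuasicoherent_of_sum e.hom (0 : A ⟶ B) e.inv 0 (by simp) hA hA

instance : (IsQuasicoherent (k := k)).IsClosedUnderKernels where
  kernels_le := by
    intro _ ⟨_, c, hc, hf⟩
    have := Fork.IsLimit.mono hc
    exact isQuasicoherent_of_kernel c.ι _ c.condition
      (ShortComplex.exact_of_f_is_kernel _ (IsLimit.ofIsoLimit hc (Fork.isoForkOfι c))) hf.1 hf.2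

instance : (IsQuasicoherent (k := k)).IsClosedUnderCokernels where
  cokernels_le := by
    intro _ ⟨_, c, hc, hf⟩
    have := Cofork.IsColimit.epi hc
    exact isQuasicoherent_of_cokernel _ c.π c.condition
      (ShortComplex.exact_of_g_is_cokernel _ (IsColimit.ofIsoColimit hc (Cofork.isoCoforkOfπ c)))
      hf.1 hf.2


instance : (IsQuasicoherent (k := k)).ContainsZero where
  exists_zero := by
    have key : ∀ X : WalkingSpanᵒᵖ, Subsingleton ((0 : Rep k).obj X) := fun X =>
      ModuleCat.subsingleton_of_isZero
        ((PresheafOfModules.evaluation (structureRings k) X).map_isZero (isZero_zero (Rep k)))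
    refine ⟨0, isZero_zero _, ?_, ?_⟩
    · refine (isLocalizedModule_powers_iff _ _
        (isUnit_restrictScalars _ (isUnit_ιU_X k) _)).2 ⟨fun p => ?_, fun m hm => ?_⟩
      · exact ⟨0, 0, (key (op WalkingSpan.zero)).elim _ _⟩
      · exact ⟨0, (key (op WalkingSpan.left)).elim _ _⟩
    · refine (isLocalizedModule_powers_iff _ _
        (isUnit_restrictScalars _ (isUnit_ιV_X k) _)).2 ⟨fun p => ?_, fun m hm => ?_⟩
      · exact ⟨0, 0, (key (op WalkingSpan.zero)).elim _ _⟩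
      · exact ⟨0, (key (op WalkingSpan.right)).elim _ _⟩

instance : (IsQuasicoherent (k := k)).IsClosedUnderFiniteProducts := by
  have : (IsQuasicoherent (k := k)).IsClosedUnderBinaryProducts := by
    refine ⟨?_⟩
    rintro X ⟨p⟩
    let e : X ≅ p.diag.obj ⟨WalkingPair.left⟩ ⊞ p.diag.obj ⟨WalkingPair.right⟩ :=
      IsLimit.conePointsIsoOfNatIso p.isLimit (BinaryBiproduct.isLimit _ _) (diagramIsoPair _)
    refine IsQuasicoherent.prop_of_iso e.symm ?_
    exact isQuasicoherent_of_sum biprod.inl biprod.inr biprod.fst biprod.snd biprod.total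
      (p.prop_diag_obj _) (p.prop_diag_obj _)
  exact ObjectProperty.IsClosedUnderFiniteProducts.mk'

end Rep

variable (k)

/-- The category `Qco(P¹(k))` of quasi-coherent sheaves on the projective line, as the full
subcategory of quasi-coherent representations. It is abelian. -/
abbrev Qco : Type (u + 1) := (Rep.IsQuasicoherent (k := k)).FullSubcategory

section twist

/-- The inclusion `k[x] → k[x, x⁻¹]` as a map of `k[x]`-modules. -/
def twistU : ModuleCat.of k[X] k[X] ⟶
    (ModuleCat.restrictScalars (ιU k)).obj (ModuleCat.of k[T;T⁻¹] k[T;T⁻¹]) :=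
  ModuleCat.ofHom (Y := (ModuleCat.restrictScalars (ιU k)).obj (ModuleCat.of k[T;T⁻¹] k[T;T⁻¹]))
    { toFun := fun p => (ιU k p : k[T;T⁻¹])
      map_add' := fun p q => map_add (ιU k) p q
      map_smul' := fun r p => map_mul (ιU k) r p }

/-- The map `k[x⁻¹] → k[x, x⁻¹]`, `q ↦ xⁿ q`, of `k[x⁻¹]`-modules. -/
def twistV (n : ℤ) : ModuleCat.of k[X] k[X] ⟶
    (ModuleCat.restrictScalars (ιV k)).obj (ModuleCat.of k[T;T⁻¹] k[T;T⁻¹]) :=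
  ModuleCat.ofHom (Y := (ModuleCat.restrictScalars (ιV k)).obj (ModuleCat.of k[T;T⁻¹] k[T;T⁻¹]))
    { toFun := fun q => (LaurentPolynomial.T n * ιV k q : k[T;T⁻¹])
      map_add' := fun p q =>
        (congrArg (LaurentPolynomial.T n * ·) (map_add (ιV k) p q)).trans (mul_add _ _ _)
      map_smul' := fun r q =>
        (congrArg (LaurentPolynomial.T n * ·) (map_mul (ιV k) r q)).trans
          (mul_left_comm (LaurentPolynomial.T n) (ιV k r) (ιV k q)) }

lemma ιV_injective : Function.Injective (ιV k) :=
  (LaurentPolynomial.invert (R := k)).injective.comp Polynomial.toLaurent_injective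

lemma exists_ιU (p : k[T;T⁻¹]) : ∃ (j : ℕ) (q : k[X]), ιU k (Polynomial.X ^ j) * p = ιU k q := by
  obtain ⟨j, q, hq⟩ := LaurentPolynomial.exists_T_pow p
  refine ⟨j, q, ?_⟩
  rw [hq, mul_comm, map_pow, ιU, Polynomial.toLaurent_X, LaurentPolynomial.T_pow, mul_one]

lemma exists_ιV (n : ℤ) (p : k[T;T⁻¹]) : ∃ (j : ℕ) (q : k[X]),
    ιV k (Polynomial.X ^ j) * p = LaurentPolynomial.T n * ιV k q := by
  obtain ⟨j, q, hq⟩ := LaurentPolynomial.exists_T_pow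
    (LaurentPolynomial.invert (LaurentPolynomial.T (-n) * p))
  refine ⟨j, q, ?_⟩
  have h1 : ιV k q = LaurentPolynomial.T (-n) * p * LaurentPolynomial.T (-j) := by
    change LaurentPolynomial.invert (Polynomial.toLaurent q) = _
    rw [hq, map_mul, LaurentPolynomial.invert_T, LaurentPolynomial.involutive_invert]
  rw [h1, map_pow, ιV_X, LaurentPolynomial.T_pow, ← mul_assoc, ← mul_assoc,
    ← LaurentPolynomial.T_add, add_neg_cancel, LaurentPolynomial.T_zero, one_mul, mul_comm,
    mul_neg_one]

lemma twist_isQuasicoherent (n : ℤ) : Rep.IsQuasicoherent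
    (Rep.mk (ModuleCat.of k[X] k[X]) (ModuleCat.of k[X] k[X]) (ModuleCat.of k[T;T⁻¹] k[T;T⁻¹])
      (twistU k) (twistV k n)) := by
  constructor
  · refine (isLocalizedModule_powers_iff _ _
      (isUnit_restrictScalars _ (isUnit_ιU_X k) _)).2
        ⟨fun (p : k[T;T⁻¹]) => exists_ιU k p, fun (m : k[X]) hm => ⟨0, ?_⟩⟩
    have h : m = (0 : k[X]) := Polynomial.toLaurent_injective (hm.trans (map_zero (ιU k)).symm)
    change (Polynomial.X ^ 0 * m : k[X]) = 0
    rw [h, mul_zero]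
  · refine (isLocalizedModule_powers_iff _ _
      (isUnit_restrictScalars _ (isUnit_ιV_X k) _)).2
        ⟨fun (p : k[T;T⁻¹]) => exists_ιV k n p, fun (m : k[X]) hm => ⟨0, ?_⟩⟩
    have h0 : LaurentPolynomial.T n * ιV k m = 0 := hm
    have h1 : ιV k m = 0 := ((LaurentPolynomial.isUnit_T n).mul_right_eq_zero).1 h0
    have h : m = (0 : k[X]) := ιV_injective k (h1.trans (map_zero (ιV k)).symm)
    change (Polynomial.X ^ 0 * m : k[X]) = 0
    rw [h, mul_zero]

/-- The sheaf `𝒪(n)`: the representation `k[x] → k[x, x⁻¹] ← k[x⁻¹]` whose first map is the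
inclusion and whose second map is `q ↦ xⁿ q`. -/
def twist (n : ℤ) : Qco k := ⟨_, twist_isQuasicoherent k n⟩

end twist

/-- The locally projective quasi-coherent sheaves. -/
def locallyProjective : ObjectProperty (Qco k) := fun F =>
  Module.Projective k[X] F.obj.onU ∧ Module.Projective k[T;T⁻¹] F.obj.onUV ∧
    Module.Projective k[X] F.obj.onV

/-- The class `𝒰^⊥` for `𝒰 = {𝒪(n) : n ∈ ℤ}`. -/
def twistPerp : ObjectProperty (Qco k) :=
  CotorsionTheory.rightPerp (ObjectProperty.ofObj (twist k))

end

end ProjLine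

end ProjectiveLine

/-! Write `Y_U`, `Y_V`, `Y_B` for the sections of a sheaf `Y` over the two charts and over their
intersection. The class `𝒰^⊥` consists of the `Y` with `Y_B = xⁿ Y_U + Y_V` for all `n`, that is,
`H¹` of every twist vanishes (`twistPerp_eq`). This condition passes to quotients, which makes the
complexes manageable.

The hard point is that such a `Y` has no extensions by any locally projective `V`, of whatever rank.
By a Čech argument this says that every map `V_B → Y_B` is a map coming from `U` plus a map coming
from `V` (`exists_decomposition`). After adding a trivial summand both modules of sections of `V`
are free, so `V` is given by two bases of one module over the Laurent polynomials. The first basis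
can be well-ordered so that its initial segments filter `V` with successive quotients `𝒪(m)`
(`exists_leading_vectors`); the decomposition is then built by transfinite recursion, as in Eklof's
lemma.

The same decomposition shows that `Hom(E, Y)` is exact for every `E` in `𝒫̃` and every `Y` with
terms in `𝒰^⊥` (`acyclic_homComplex`): over each affine piece `E` is contractible, and the local
primitives of a cocycle are glued by a Mayer–Vietoris argument. Hence the dg class is simply the
class of complexes with all terms in `𝒰^⊥`.

Every sheaf embeds in an object of `𝒰^⊥` with locally projective cokernel, by an explicit extension
(`hasEnoughInjectives`). Closure under quotients lifts this to complexes: each complex embeds in one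
with terms in `𝒰^⊥`, the cokernel being a sum of disks on locally projective sheaves
(`exists_diskSum_extension`). Salce's trick gives the other approximation sequence. Sums of disks on
the `𝒪(n)` already detect the terms of a complex, so they form a cogenerating set. -/

section CotorsionGeneral

open CategoryTheory CategoryTheory.Limits

namespace CotorsionTheory

universe v w

variable {A : Type w} [Category.{v} A] [Abelian A]

/-! ### Short exact sequences and vanishing of `Ext¹`. -/

section Extensions

variable {Y W F D : A}

lemma pullback_shortExact {i : Y ⟶ W} {p : W ⟶ F} {w : i ≫ p = 0}
    (h : (ShortComplex.mk i p w).ShortExact) (g : D ⟶ F) :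
    (ShortComplex.mk (pullback.lift i (0 : Y ⟶ D) (by simp [w])) (pullback.snd p g)
      (pullback.lift_snd _ _ _)).ShortExact := by
  have : Mono i := h.mono_f
  have : Epi p := h.epi_g
  have hm : Mono (pullback.lift i (0 : Y ⟶ D) (by simp [w] : i ≫ p = 0 ≫ g)) :=
    mono_of_mono_fac (pullback.lift_fst i (0 : Y ⟶ D) (by simp [w]))
  refine { exact := ?_, mono_f := hm, epi_g := inferInstanceAs (Epi (pullback.snd p g)) }
  refine ShortComplex.exact_of_f_is_kernel _ (KernelFork.IsLimit.ofι' _ _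
    fun {T} (x : T ⟶ pullback p g) (hx : x ≫ pullback.snd p g = 0) => ?_)
  have h0 : (x ≫ pullback.fst p g) ≫ p = 0 := by
    rw [Category.assoc, pullback.condition, reassoc_of% hx, zero_comp]
  have key : ∃ l : T ⟶ Y, l ≫ i = x ≫ pullback.fst p g :=
    ⟨h.exact.lift _ h0, h.exact.lift_f _ h0⟩
  let l := key.choose
  have hl : l ≫ i = x ≫ pullback.fst p g := key.choose_spec
  refine ⟨l, ?_⟩
  apply pullback.hom_ext
  · exact (Category.assoc _ _ _).trans ((congrArg (l ≫ ·) (pullback.lift_fst _ _ _)).trans hl)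
  · exact (Category.assoc _ _ _).trans
      ((congrArg (l ≫ ·) (pullback.lift_snd _ _ _)).trans (comp_zero.trans hx.symm))

lemma exists_shortExact_of_isPushout {i : Y ⟶ W} {p : W ⟶ F} {w : i ≫ p = 0}
    (h : (ShortComplex.mk i p w).ShortExact) {P : A} {g : Y ⟶ D} {inl : W ⟶ P} {inr : D ⟶ P}
    (sq : IsPushout i g inl inr) :
    ∃ (q : P ⟶ F) (w' : inr ≫ q = 0), (ShortComplex.mk inr q w').ShortExact ∧ inl ≫ q = p := by
  have := h.mono_f
  have := h.epi_g
  dsimp at *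
  have w0 : i ≫ p = g ≫ 0 := by simp [w]
  have hl : inl ≫ sq.desc p 0 w0 = p := sq.inl_desc _ _ _
  have hr : inr ≫ sq.desc p 0 w0 = 0 := sq.inr_desc _ _ _
  refine ⟨sq.desc p 0 w0, hr, ?_, hl⟩
  have hm : Mono inr := by
    have := sq.flip
    rw [← this.inl_isoPushout_inv]
    infer_instance
  have he : Epi (sq.desc p 0 w0) := epi_of_epi_fac hl
  refine { exact := ?_, mono_f := hm, epi_g := he }
  refine ShortComplex.exact_of_g_is_cokernel _ (CokernelCofork.IsColimit.ofπ' _ _ fun x hx => ?_)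
  refine ⟨h.exact.desc (inl ≫ x) ?_, ?_⟩
  · dsimp at hx ⊢
    rw [sq.w_assoc, hx, comp_zero]
  · dsimp at hx ⊢
    apply sq.hom_ext
    · rw [reassoc_of% hl]; exact h.exact.g_desc _ _
    · rw [reassoc_of% hr, zero_comp, hx]

/-- Maps `D ⟶ F` lift along an epimorphism `W ⟶ F` with kernel `Y` if `Ext¹(D, Y) = 0`. -/
lemma ExtOneVanishes.exists_lift (hE : ExtOneVanishes D Y) {i : Y ⟶ W} {p : W ⟶ F}
    {w : i ≫ p = 0} (h : (ShortComplex.mk i p w).ShortExact) (g : D ⟶ F) :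
    ∃ l : D ⟶ W, l ≫ p = g := by
  obtain ⟨s⟩ := hE _ _ _ _ (pullback_shortExact h g)
  refine ⟨s.s ≫ pullback.fst p g, ?_⟩
  have := s.s_g
  dsimp at this
  rw [Category.assoc, pullback.condition, ← Category.assoc, this, Category.id_comp]

/-- Maps `Y ⟶ D` extend along a monomorphism `Y ⟶ W` with cokernel `F` if `Ext¹(F, D) = 0`. -/
lemma ExtOneVanishes.exists_extension (hE : ExtOneVanishes F D) {i : Y ⟶ W} {p : W ⟶ F}
    {w : i ≫ p = 0} (h : (ShortComplex.mk i p w).ShortExact) (g : Y ⟶ D) :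
    ∃ l : W ⟶ D, i ≫ l = g := by
  obtain ⟨q, w', hq, -⟩ := exists_shortExact_of_isPushout h (IsPushout.of_hasPushout i g)
  obtain ⟨s⟩ := hE _ _ _ _ hq
  refine ⟨pushout.inl i g ≫ s.r, ?_⟩
  have := s.f_r
  dsimp at this
  rw [← Category.assoc, pushout.condition, Category.assoc, this, Category.comp_id]

lemma splitting_of_retraction {i : Y ⟶ W} {p : W ⟶ F} {w : i ≫ p = 0}
    (h : (ShortComplex.mk i p w).ShortExact) (r : W ⟶ Y) (hr : i ≫ r = 𝟙 Y) :
    Nonempty (ShortComplex.mk i p w).Splitting :=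
  ⟨ShortComplex.Splitting.ofExactOfRetraction _ h.exact r hr h.epi_g⟩

/-- `Ext¹(D, Y) = 0` can be tested on one short exact sequence `0 ⟶ Y ⟶ W ⟶ F ⟶ 0` with
`Ext¹(D, W) = 0`. -/
lemma extOneVanishes_of_lift (hE : ExtOneVanishes D W) {i : Y ⟶ W} {p : W ⟶ F}
    {w : i ≫ p = 0} (h : (ShortComplex.mk i p w).ShortExact)
    (hl : ∀ g : D ⟶ F, ∃ l : D ⟶ W, l ≫ p = g) : ExtOneVanishes D Y := by
  intro X j q w' hX
  have := h.mono_f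
  have := hX.epi_g
  dsimp at *
  obtain ⟨t, ht⟩ := hE.exists_extension hX i
  obtain ⟨l, hl⟩ := hl (hX.exact.desc (t ≫ p) (by
    dsimp; rw [← Category.assoc, ht, w]))
  have h1 : q ≫ l ≫ p = t ≫ p := by rw [hl]; exact hX.exact.g_desc _ _
  have h2 : (t - q ≫ l) ≫ p = 0 := by simp [h1]
  refine splitting_of_retraction hX (h.exact.lift (t - q ≫ l) h2) ?_
  rw [← cancel_mono i, Category.assoc]
  refine (congrArg (j ≫ ·) (h.exact.lift_f (t - q ≫ l) h2)).trans ?_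
  simp [ht, reassoc_of% w']

end Extensions

section Reindex

/-- Every integer is of the form `m + 1`, so data indexed by successors can be reindexed; the
transport is done here once, to keep it out of the constructions of complexes. -/
lemma exists_family_succ {β : ℤ → Type*} (P : ∀ m : ℤ, β (m + 1) → Prop)
    (h : ∀ m, ∃ b, P m b) : ∃ b : ∀ n, β n, ∀ m, P m (b (m + 1)) := by
  have key : ∀ n : ℤ, ∃ b : β n, ∀ m (hm : n = m + 1), P m (hm ▸ b) := by
    intro n
    obtain ⟨m, rfl⟩ : ∃ m, n = m + 1 := ⟨n - 1, by omega⟩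
    obtain ⟨b, hb⟩ := h m
    refine ⟨b, fun m' hm => ?_⟩
    obtain rfl : m = m' := by omega
    exact hb
  choose b hb using key
  exact ⟨b, fun m => hb (m + 1) m rfl⟩

end Reindex

/-! ### Sums of disk complexes. -/

section DiskSum

variable (Q : ℤ → A)

/-- The direct sum of the disk complexes `Q n = Q n` in degrees `n - 1` and `n`. -/
noncomputable def diskSum : CochainComplex A ℤ :=
  CochainComplex.of (fun n => Q (n + 1) ⊞ Q n) (fun _ => biprod.fst ≫ biprod.inr) (by simp)

/-- The terms of `diskSum Q`. -/
noncomputable def diskSumXIso (n : ℤ) : (diskSum Q).X n ≅ Q (n + 1) ⊞ Q n := Iso.refl _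

lemma diskSum_d (n : ℤ) : (diskSum Q).d n (n + 1) =
    (diskSumXIso Q n).hom ≫ biprod.fst ≫ biprod.inr ≫ (diskSumXIso Q (n + 1)).inv := by
  refine (CochainComplex.of_d (fun n => Q (n + 1) ⊞ Q n)
    (fun _ => biprod.fst ≫ biprod.inr) n).trans ?_
  exact ((Category.id_comp _).trans (congrArg (biprod.fst ≫ ·) (Category.comp_id _))).symm

lemma comp_diskSum_d_eq_zero_iff {T : A} (n : ℤ) (x : T ⟶ (diskSum Q).X n) :
    x ≫ (diskSum Q).d n (n + 1) = 0 ↔ x ≫ (diskSumXIso Q n).hom ≫ biprod.fst = 0 := by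
  rw [diskSum_d, ← cancel_mono ((biprod.inr : Q (n + 1) ⟶ Q (n + 1 + 1) ⊞ Q (n + 1)) ≫
    (diskSumXIso Q (n + 1)).inv)]
  simp

lemma diskSum_acyclic : (diskSum Q).Acyclic := by
  intro n
  obtain ⟨m, rfl⟩ : ∃ m, n = m + 1 := ⟨n - 1, by omega⟩
  rw [HomologicalComplex.exactAt_iff' _ m (m + 1) (m + 1 + 1) (by simp) (by simp)]
  rw [ShortComplex.exact_iff_exact_up_to_refinements]
  intro T (x : T ⟶ (diskSum Q).X (m + 1)) (hx : x ≫ (diskSum Q).d (m + 1) (m + 1 + 1) = 0)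
  rw [comp_diskSum_d_eq_zero_iff] at hx
  let y : T ⟶ (diskSum Q).X m :=
    x ≫ (diskSumXIso Q (m + 1)).hom ≫ biprod.snd ≫ biprod.inl ≫ (diskSumXIso Q m).inv
  refine ⟨T, 𝟙 T, inferInstance, y, ?_⟩
  change 𝟙 T ≫ x = y ≫ (diskSum Q).d m (m + 1)
  rw [diskSum_d, ← cancel_mono (diskSumXIso Q (m + 1)).hom]
  apply biprod.hom_ext
  · simpa using hx
  · simp [y]

/-- The cycles of `diskSum Q` are the given objects. -/
noncomputable def diskSumCycles (n : ℤ) : (diskSum Q).cycles n ≅ Q n where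
  hom := (diskSum Q).iCycles n ≫ (diskSumXIso Q n).hom ≫ biprod.snd
  inv := (diskSum Q).liftCycles (biprod.inr ≫ (diskSumXIso Q n).inv) (n + 1) (by simp)
    (by rw [comp_diskSum_d_eq_zero_iff]; simp)
  hom_inv_id := by
    have h := (comp_diskSum_d_eq_zero_iff Q n _).1 ((diskSum Q).iCycles_d n (n + 1))
    rw [← cancel_mono ((diskSum Q).iCycles n), ← cancel_mono (diskSumXIso Q n).hom]
    apply biprod.hom_ext
    · simp [h]
    · simp
  inv_hom_id := by simp

lemma diskSum_mem {ℱ : ObjectProperty A} [ℱ.IsClosedUnderIsomorphisms] (hQ : ∀ n, ℱ (Q n)) :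
    exactWithCyclesIn ℱ (diskSum Q) :=
  ⟨diskSum_acyclic Q, fun n => ℱ.prop_of_iso (diskSumCycles Q n).symm (hQ n)⟩

/-- A disk is free on its upper-left entry: the component on `Q (n + 1)` in degree `n` is arbitrary,
and the component one degree up is forced to be its composite with the differential. -/
lemma exists_hom_from_diskSum {Z : CochainComplex A ℤ} (r : ∀ n : ℤ, Q (n + 1) ⟶ Z.X n) :
    ∃ f : diskSum Q ⟶ Z, ∀ n, biprod.inl ≫ (diskSumXIso Q n).inv ≫ f.f n = r n := by
  obtain ⟨r', hr'⟩ := exists_family_succ (β := fun n => Q n ⟶ Z.X n)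
    (fun m b => b = r m ≫ Z.d m (m + 1)) (fun m => ⟨_, rfl⟩)
  have hd : ∀ n, r' n ≫ Z.d n (n + 1) = 0 := by
    intro n
    obtain ⟨m, rfl⟩ : ∃ m, n = m + 1 := ⟨n - 1, by omega⟩
    simp [hr']
  refine ⟨{ f := fun n => (diskSumXIso Q n).hom ≫ biprod.desc (r n) (r' n), comm' := ?_ },
    fun n => by simp⟩
  rintro n _ rfl
  rw [diskSum_d, ← cancel_epi (diskSumXIso Q n).inv]
  apply biprod.hom_ext'
  · simp [hr']
  · simp [hd]

end DiskSum

/-! ### Cotorsion pairs of complexes. -/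

section Complexes

variable {ℱ 𝒞 : ObjectProperty A}

/-- Embed each term `Z n` in some `C n` with cokernel `Q (n + 1)` and extend the differential to `δ`
on the `C n`. The square of `δ` need not vanish, but it kills `Z`, so it factors through the
cokernels by `σ`. A perturbed mapping cone on `C n ⊞ Q n` absorbs this error. Its terms lie in `𝒞`
because `Q n` is a quotient of `C (n - 1)`. -/
lemma exists_diskSum_extension [ℱ.IsClosedUnderIsomorphisms]
    (hperp : ∀ F C, ℱ F → 𝒞 C → ExtOneVanishes F C)
    (hinj : HasEnoughInjectives ℱ 𝒞)
    (hquot : ∀ {C D : A} (p : C ⟶ D) [Epi p], 𝒞 C → 𝒞 D)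
    (hsum : ∀ C D : A, 𝒞 C → 𝒞 D → 𝒞 (C ⊞ D)) (Z : CochainComplex A ℤ) :
    ∃ (W : CochainComplex A ℤ) (Q : ℤ → A) (i : Z ⟶ W) (p : W ⟶ diskSum Q) (w : i ≫ p = 0),
      (ShortComplex.mk i p w).ShortExact ∧ (∀ n, 𝒞 (W.X n)) ∧ ∀ n, ℱ (Q n) := by
  choose C Q' i p' w' hS' hC hQ' using fun n => hinj (Z.X n)
  obtain ⟨Q, hQ⟩ := exists_family_succ (β := fun _ => A)
    (fun m b => ∃ (p : C m ⟶ b) (w : i m ≫ p = 0), (ShortComplex.mk (i m) p w).ShortExact ∧ ℱ b)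
    (fun m => ⟨Q' m, p' m, w' m, hS' m, hQ' m⟩)
  choose p w hS hF using hQ
  have hp : ∀ n, Epi (p n) := fun n => (hS n).epi_g
  have hi : ∀ n, Mono (i n) := fun n => (hS n).mono_f
  have hQF : ∀ n, ℱ (Q n) := fun n => by
    obtain ⟨m, rfl⟩ : ∃ m, n = m + 1 := ⟨n - 1, by omega⟩
    exact hF m
  have hQC : ∀ n, 𝒞 (Q n) := fun n => by
    obtain ⟨m, rfl⟩ : ∃ m, n = m + 1 := ⟨n - 1, by omega⟩
    exact hquot (p m) (hC m)
  choose δ hδ using fun n => (hperp _ _ (hF n) (hC (n + 1))).exists_extension (hS n)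
    (Z.d n (n + 1) ≫ i (n + 1))
  obtain ⟨δ', hδ'⟩ := exists_family_succ (β := fun n => Q n ⟶ Q (n + 1))
    (fun m b => p m ≫ b = δ m ≫ p (m + 1)) (fun m => ⟨(hS m).exact.desc (δ m ≫ p (m + 1)) (by
      dsimp; rw [reassoc_of% hδ, w, comp_zero]), (hS m).exact.g_desc _ _⟩)
  obtain ⟨σ, hσ⟩ := exists_family_succ (β := fun n => Q n ⟶ C (n + 1))
    (fun m b => p m ≫ b = δ m ≫ δ (m + 1)) (fun m => ⟨(hS m).exact.desc (δ m ≫ δ (m + 1)) (by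
      dsimp; rw [reassoc_of% hδ, hδ, Z.d_comp_d_assoc, zero_comp]), (hS m).exact.g_desc _ _⟩)
  have e1 : ∀ n, σ n ≫ p (n + 1) = δ' n ≫ δ' (n + 1) := fun n => by
    obtain ⟨m, rfl⟩ : ∃ m, n = m + 1 := ⟨n - 1, by omega⟩
    rw [← cancel_epi (p m), reassoc_of% hσ, reassoc_of% hδ', hδ']
  have e2 : ∀ n, σ n ≫ δ (n + 1) = δ' n ≫ σ (n + 1) := fun n => by
    obtain ⟨m, rfl⟩ : ∃ m, n = m + 1 := ⟨n - 1, by omega⟩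
    rw [← cancel_epi (p m), reassoc_of% hσ, reassoc_of% hδ', hσ]
  -- The entry `-σ` is chosen so that the path through `Q` cancels the square of `δ`; the other
  -- entries of `d ≫ d` vanish by the compatibilities `hδ'`, `e1` and `e2`.
  let d : ∀ n, C n ⊞ Q n ⟶ C (n + 1) ⊞ Q (n + 1) := fun n =>
    biprod.desc (biprod.lift (δ n) (p n)) (biprod.lift (-σ n) (-δ' n))
  have dd : ∀ n, d n ≫ d (n + 1) = 0 := fun n => by
    apply biprod.hom_ext' <;> apply biprod.hom_ext <;> simp [d, hσ, hδ', e1, e2]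
  obtain ⟨W, e, Wd⟩ : ∃ (W : CochainComplex A ℤ) (e : ∀ n, W.X n ≅ C n ⊞ Q n),
      ∀ n, W.d n (n + 1) = (e n).hom ≫ d n ≫ (e (n + 1)).inv :=
    ⟨CochainComplex.of (fun n => C n ⊞ Q n) d dd, fun n => Iso.refl _, fun n =>
      (CochainComplex.of_d (fun n => C n ⊞ Q n) d n).trans (by simp)⟩
  -- On `Q n` the map is the identity corrected by `-δ'`, which makes it commute with the
  -- differentials; its kernel is the kernel of `p n` in `C n`, hence `Z n`.
  let P₀ : ∀ n, C n ⊞ Q n ⟶ Q (n + 1) ⊞ Q n := fun n =>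
    biprod.desc (p n ≫ biprod.inl) (biprod.lift (-δ' n) (𝟙 _))
  let I : Z ⟶ W :=
    { f := fun n => i n ≫ biprod.inl ≫ (e n).inv
      comm' := by
        rintro n _ rfl
        rw [Wd, ← cancel_mono (e (n + 1)).hom]
        apply biprod.hom_ext <;> simp [d, hδ, w] }
  let P : W ⟶ diskSum Q :=
    { f := fun n => (e n).hom ≫ P₀ n ≫ (diskSumXIso Q n).inv
      comm' := by
        rintro n _ rfl
        rw [Wd, diskSum_d, ← cancel_mono (diskSumXIso Q (n + 1)).hom, ← cancel_epi (e n).inv]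
        apply biprod.hom_ext' <;> apply biprod.hom_ext <;> simp [d, P₀, hδ', e1] }
  have wIP : I ≫ P = 0 := by
    ext n
    simp [I, P, P₀, reassoc_of% w]
  refine ⟨W, Q, I, P, wIP, ?_, fun n => hquot (e n).inv (hsum _ _ (hC n) (hQC n)), hQF⟩
  apply HomologicalComplex.shortExact_of_degreewise_shortExact
  intro n
  have hepi : Epi (P₀ n) := by
    rw [Preadditive.epi_iff_cancel_zero]
    intro T g hg
    have h1 := biprod.inl ≫= hg
    have h2 := biprod.inr ≫= hg
    simp only [P₀, biprod.inl_desc_assoc, Category.assoc, comp_zero, biprod.inr_desc_assoc] at h1 h2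
    have h3 : biprod.inl ≫ g = 0 := by rwa [← cancel_epi (p n), comp_zero]
    apply biprod.hom_ext'
    · simpa using h3
    · have : biprod.lift (-δ' n) (𝟙 (Q n)) = -δ' n ≫ biprod.inl + biprod.inr := by
        apply biprod.hom_ext <;> simp
      rw [this] at h2
      simpa [h3] using h2
  have hmono : Mono (((ShortComplex.mk I P wIP).map
      (HomologicalComplex.eval A (ComplexShape.up ℤ) n)).f) :=
    inferInstanceAs (Mono (i n ≫ biprod.inl ≫ (e n).inv))
  have hepi' : Epi (((ShortComplex.mk I P wIP).map
      (HomologicalComplex.eval A (ComplexShape.up ℤ) n)).g) :=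
    inferInstanceAs (Epi ((e n).hom ≫ P₀ n ≫ (diskSumXIso Q n).inv))
  refine ShortComplex.ShortExact.mk' (ShortComplex.exact_of_f_is_kernel _
    (KernelFork.IsLimit.ofι' _ _ fun {T} (x : T ⟶ W.X n) (hx : x ≫ P.f n = 0) => ?_)) hmono hepi'
  have hx' : x ≫ (e n).hom ≫ P₀ n = 0 := by
    rw [← cancel_mono (diskSumXIso Q n).inv]; simpa [P] using hx
  have h2 : x ≫ (e n).hom ≫ biprod.snd = 0 := by
    have := hx' =≫ biprod.snd
    simpa [P₀, biprod.desc_eq] using this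
  have h1 : x ≫ (e n).hom ≫ biprod.fst ≫ p n = 0 := by
    have := hx' =≫ biprod.fst
    simpa [P₀, biprod.desc_eq, reassoc_of% h2] using this
  have h4 : (x ≫ (e n).hom ≫ biprod.fst) ≫ p n = 0 := by simpa using h1
  refine ⟨(hS n).exact.lift _ h4, ?_⟩
  have h3 : (hS n).exact.lift _ h4 ≫ i n = _ := (hS n).exact.lift_f _ h4
  change (hS n).exact.lift _ h4 ≫ i n ≫ biprod.inl ≫ (e n).inv = x
  rw [← cancel_mono (e n).hom]
  apply biprod.hom_ext
  · simp [h3]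
  · simp [h2]

/-- Only surjectivity on cycles needs an argument: a lift of a cycle has its boundary in the exact
subcomplex, where it bounds locally, and subtracting a primitive turns the lift into a cycle. -/
lemma exactWithCyclesIn_of_extension
    (hext : ∀ {X Y Z : A} (f : X ⟶ Y) (g : Y ⟶ Z) (w : f ≫ g = 0),
      (ShortComplex.mk f g w).ShortExact → ℱ X → ℱ Z → ℱ Y)
    {S : ShortComplex (CochainComplex A ℤ)} (hS : S.ShortExact)
    (h1 : exactWithCyclesIn ℱ S.X₁) (h3 : exactWithCyclesIn ℱ S.X₃) :
    exactWithCyclesIn ℱ S.X₂ := by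
  have := hS.mono_f
  have := hS.epi_g
  refine ⟨fun n => ?_, fun n => ?_⟩
  · rw [HomologicalComplex.exactAt_iff_isZero_homology]
    exact (hS.homology_exact₂ n).isZero_X₂
      ((((HomologicalComplex.exactAt_iff_isZero_homology _ _).1 (h1.1 n)).eq_of_src _ _))
      ((((HomologicalComplex.exactAt_iff_isZero_homology _ _).1 (h3.1 n)).eq_of_tgt _ _))
  · have hn : ∀ n, (S.map (HomologicalComplex.eval A _ n)).ShortExact := fun n =>
      hS.map_of_exact _
    have hm : Mono (HomologicalComplex.cyclesMap S.f n) := inferInstance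
    refine hext (HomologicalComplex.cyclesMap S.f n) (HomologicalComplex.cyclesMap S.g n)
      (by rw [← HomologicalComplex.cyclesMap_comp, S.zero, HomologicalComplex.cyclesMap_zero])
      (ShortComplex.ShortExact.mk' (HomologicalComplex.cycles_left_exact S hS.exact n) hm ?_)
      (h1.2 n) (h3.2 n)
    rw [epi_iff_surjective_up_to_refinements]
    intro T (x : T ⟶ S.X₃.cycles n)
    have : Epi (S.g.f n) := (hn n).epi_g
    have := (hn (n + 1)).mono_f
    have : Mono (S.f.f (n + 1 + 1)) := (hn (n + 1 + 1)).mono_f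
    obtain ⟨T₁, π₁, _, y, hy⟩ := surjective_up_to_refinements_of_epi (S.g.f n)
      (x ≫ S.X₃.iCycles n)
    have hyd : (y ≫ S.X₂.d n (n + 1)) ≫ S.g.f (n + 1) = 0 := by
      rw [Category.assoc, ← S.g.comm, ← reassoc_of% hy]; simp
    let a : T₁ ⟶ S.X₁.X (n + 1) := (hn (n + 1)).exact.lift (y ≫ S.X₂.d n (n + 1)) hyd
    have ha : a ≫ S.f.f (n + 1) = y ≫ S.X₂.d n (n + 1) := (hn (n + 1)).exact.lift_f _ _
    have had : a ≫ S.X₁.d (n + 1) (n + 1 + 1) = 0 := by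
      rw [← cancel_mono (S.f.f (n + 1 + 1)), Category.assoc, ← S.f.comm, reassoc_of% ha]
      simp
    have hex := h1.1 (n + 1)
    rw [HomologicalComplex.exactAt_iff' _ n (n + 1) (n + 1 + 1) (by simp) (by simp),
      ShortComplex.exact_iff_exact_up_to_refinements] at hex
    obtain ⟨T₂, π₂, _, (b : T₂ ⟶ S.X₁.X n), hb⟩ := hex a had
    change π₂ ≫ a = b ≫ S.X₁.d n (n + 1) at hb
    have hz : (π₂ ≫ y - b ≫ S.f.f n) ≫ S.X₂.d n (n + 1) = 0 := by
      rw [Preadditive.sub_comp, Category.assoc, Category.assoc, S.f.comm, ← reassoc_of% hb, ha,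
        sub_self]
    refine ⟨T₂, π₂ ≫ π₁, inferInstance, S.X₂.liftCycles (π₂ ≫ y - b ≫ S.f.f n) (n + 1)
      (by simp) hz, ?_⟩
    rw [← cancel_mono (S.X₃.iCycles n)]
    have hfg : S.f.f n ≫ S.g.f n = 0 := (S.map (HomologicalComplex.eval A _ n)).zero
    simp [hy, hfg]

lemma exactWithCyclesIn_of_retract [ℱ.IsClosedUnderIsomorphisms]
    (hret : ∀ {X Y : A} (i : X ⟶ Y) (r : Y ⟶ X), i ≫ r = 𝟙 X → ℱ Y → ℱ X)
    {X Y : CochainComplex A ℤ} (i : X ⟶ Y) (r : Y ⟶ X) (h : i ≫ r = 𝟙 X)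
    (hY : exactWithCyclesIn ℱ Y) : exactWithCyclesIn ℱ X := by
  refine ⟨fun n => ?_, fun n => ?_⟩
  · rw [HomologicalComplex.exactAt_iff_isZero_homology]
    have h' : HomologicalComplex.homologyMap i n ≫ HomologicalComplex.homologyMap r n = 𝟙 _ := by
      rw [← HomologicalComplex.homologyMap_comp, h, HomologicalComplex.homologyMap_id]
    rw [IsZero.iff_id_eq_zero, ← h',
      ((HomologicalComplex.exactAt_iff_isZero_homology _ _).1 (hY.1 n)).eq_of_tgt
        (HomologicalComplex.homologyMap i n) 0, zero_comp]
  · refine hret (HomologicalComplex.cyclesMap i n) (HomologicalComplex.cyclesMap r n) ?_ (hY.2 n)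
    rw [← HomologicalComplex.cyclesMap_comp, h, HomologicalComplex.cyclesMap_id]

lemma exists_shortExact_cycles {E : CochainComplex A ℤ} (hE : E.Acyclic) (n : ℤ) :
    ∃ (q : E.X n ⟶ E.cycles (n + 1)) (w : E.iCycles n ≫ q = 0),
      q ≫ E.iCycles (n + 1) = E.d n (n + 1) ∧ (ShortComplex.mk _ q w).ShortExact := by
  refine ⟨E.liftCycles (E.d n (n + 1)) (n + 1 + 1) (by simp) (by simp),
    by rw [← cancel_mono (E.iCycles (n + 1))]; simp, by simp, ?_⟩
  have he : Epi (E.liftCycles (E.d n (n + 1)) (n + 1 + 1) (by simp) (by simp)) := by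
    rw [epi_iff_surjective_up_to_refinements]
    intro T x
    have hex := hE (n + 1)
    rw [HomologicalComplex.exactAt_iff' _ n (n + 1) (n + 1 + 1) (by simp) (by simp),
      ShortComplex.exact_iff_exact_up_to_refinements] at hex
    obtain ⟨T', π, _, (y : T' ⟶ E.X n), hy⟩ := hex (x ≫ E.iCycles (n + 1))
      (by change (x ≫ E.iCycles (n + 1)) ≫ E.d (n + 1) (n + 1 + 1) = 0; simp)
    change π ≫ x ≫ E.iCycles (n + 1) = y ≫ E.d n (n + 1) at hy
    exact ⟨T', π, inferInstance, y, by rw [← cancel_mono (E.iCycles (n + 1))]; simpa using hy⟩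
  have hm : Mono (E.iCycles n) := inferInstance
  refine ShortComplex.ShortExact.mk' (ShortComplex.exact_of_f_is_kernel _
    (KernelFork.IsLimit.ofι' _ _ fun {T} (x : T ⟶ E.X n) (hx : x ≫ _ = 0) => ?_)) hm he
  have hx' := hx =≫ E.iCycles (n + 1)
  simp only [Category.assoc, HomologicalComplex.liftCycles_i, zero_comp] at hx'
  exact ⟨E.liftCycles x (n + 1) (by simp) hx', E.liftCycles_i _ _ _ _⟩

open CochainComplex HomComplex

lemma homComplex_acyclic_iff {C : Type*} [Category C] [Preadditive C] (E Y : CochainComplex C ℤ) :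
    (HomComplex E Y).Acyclic ↔ ∀ (m n : ℤ) (_ : m + 1 = n) (z : Cochain E Y n),
      δ n (n + 1) z = 0 → ∃ y : Cochain E Y m, δ m n y = z := by
  have key : ∀ m n : ℤ, m + 1 = n → ((HomComplex E Y).ExactAt n ↔
      ∀ z : Cochain E Y n, δ n (n + 1) z = 0 → ∃ y : Cochain E Y m, δ m n y = z) := by
    rintro m _ rfl
    rw [HomologicalComplex.exactAt_iff' _ m (m + 1) (m + 1 + 1) (by simp) (by simp),
      ShortComplex.ab_exact_iff]
    rfl
  exact ⟨fun h m n hmn => (key m n hmn).1 (h n),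
    fun h n => (key (n - 1) n (by omega)).2 (h (n - 1) n (by omega))⟩

/-- An acyclic complex with projective cycles is contractible. -/
lemma exists_contraction {E : CochainComplex A ℤ} (hE : E.Acyclic)
    (hp : ∀ n, Projective (E.cycles n)) :
    ∃ h : Cochain E E (-1), δ (-1) 0 h = Cochain.ofHom (𝟙 E) := by
  choose q w hq hS using exists_shortExact_cycles hE
  have sp := fun n => (hS n).splittingOfProjective
  obtain ⟨r, hr⟩ : ∃ r : ∀ n, E.X n ⟶ E.cycles n, ∀ n, r n = (sp n).r := ⟨_, fun _ => rfl⟩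
  obtain ⟨s, hs⟩ : ∃ s : ∀ n, E.cycles (n + 1) ⟶ E.X n, ∀ n, s n = (sp n).s := ⟨_, fun _ => rfl⟩
  have h1 : ∀ n, s n ≫ E.d n (n + 1) = E.iCycles (n + 1) := fun n => by
    have : s n ≫ q n = 𝟙 _ := by rw [hs]; exact (sp n).s_g
    rw [← hq, reassoc_of% this]
  have h2 : ∀ n, E.iCycles n ≫ r n = 𝟙 _ := fun n => by rw [hr]; exact (sp n).f_r
  have h3 : ∀ n, r n ≫ E.iCycles n + q n ≫ s n = 𝟙 _ := fun n => by
    rw [hr, hs]; exact (sp n).id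
  obtain ⟨t, ht⟩ := exists_family_succ (β := fun n => E.cycles n ⟶ E.X (n - 1))
    (fun m b => b = s m ≫ eqToHom (by congr 1; omega)) (fun m => ⟨_, rfl⟩)
  -- The contraction retracts a term onto its cycles and then lifts these cycles one degree down
  -- through the chosen section.
  refine ⟨Cochain.mk fun p q hpq => r p ≫ t p ≫ eqToHom (by congr 1), ?_⟩
  ext p
  obtain ⟨m, rfl⟩ : ∃ m, p = m + 1 := ⟨p - 1, by omega⟩
  rw [δ_v (-1) 0 (by simp) _ (m + 1) (m + 1) (by simp) m (m + 1 + 1) (by simp) (by simp)]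
  simp only [Cochain.mk_v, ht, Category.assoc, eqToHom_trans, eqToHom_refl, Category.comp_id,
    Cochain.ofHom_v, HomologicalComplex.id_f, h1]
  rw [← hq (m + 1), Category.assoc, reassoc_of% h2]
  simpa using h3 (m + 1)

/-- An extension of `E` by `Y` splits in each degree, and the failure of the degreewise sections to
commute with the differentials is a cocycle of degree one in `Hom(E, Y)`. A primitive of it corrects
the sections to a chain map. -/
lemma extOneVanishes_of_homComplex_acyclic {E Y : CochainComplex A ℤ}
    (h : (HomComplex E Y).Acyclic) (hEY : ∀ n, ExtOneVanishes (E.X n) (Y.X n)) :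
    ExtOneVanishes E Y := by
  intro X i p w hS
  have hn : ∀ n, ((ShortComplex.mk i p w).map (HomologicalComplex.eval A _ n)).ShortExact :=
    fun n => hS.map_of_exact _
  have hs : ∀ n, Nonempty ((ShortComplex.mk i p w).map
    (HomologicalComplex.eval A (ComplexShape.up ℤ) n)).Splitting := fun n => hEY n _ _ _ _ (hn n)
  let σ := fun n => (hs n).some
  obtain ⟨y, hy⟩ := (homComplex_acyclic_iff E Y).1 h 0 1 (by simp)
    (cocycleOfDegreewiseSplit _ σ).1 (Cocycle.δ_eq_zero _ _)
  obtain ⟨s, hs⟩ : ∃ s : ∀ n, E.X n ⟶ X.X n, ∀ n, s n = (σ n).s := ⟨_, fun _ => rfl⟩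
  obtain ⟨r, hr⟩ : ∃ r : ∀ n, X.X n ⟶ Y.X n, ∀ n, r n = (σ n).r := ⟨_, fun _ => rfl⟩
  have hc : ∀ n, s n ≫ X.d n (n + 1) ≫ r (n + 1) =
      y.v n n (by simp) ≫ Y.d n (n + 1) - E.d n (n + 1) ≫ y.v (n + 1) (n + 1) (by simp) := by
    intro n
    rw [← δ_zero_cochain_v _ _ _ rfl, hy, hs, hr]
    rfl
  have sg : ∀ n, s n ≫ p.f n = 𝟙 _ := fun n => by rw [hs]; exact (σ n).s_g
  have ri : ∀ n, r n ≫ i.f n = 𝟙 _ - p.f n ≫ s n := fun n => by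
    rw [hs, hr]; exact (σ n).r_f
  have hw : ∀ n, i.f n ≫ p.f n = 0 := fun n => by rw [← HomologicalComplex.comp_f, w]; rfl
  let t : E ⟶ X :=
    { f := fun n => s n - y.v n n (by simp) ≫ i.f n
      comm' := by
        rintro n _ rfl
        have h1 := hc n =≫ i.f (n + 1)
        simp only [Category.assoc, ri, Preadditive.comp_sub, Category.comp_id,
          Preadditive.sub_comp, ← p.comm_assoc, reassoc_of% sg] at h1
        simp only [Preadditive.comp_sub, Preadditive.sub_comp, Category.assoc, i.comm]
        rw [sub_eq_sub_iff_sub_eq_sub, h1] }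
  refine ⟨ShortComplex.Splitting.ofExactOfSection _ hS.exact t ?_ hS.mono_f⟩
  ext n
  simp [t, sg, hw]

/-- Cotorsion pairs of complexes: if `(ℱ, 𝒞)` is a complete cotorsion pair such that `𝒞` is closed
under quotients and is cogenerated by a set, and if `Hom(E, Y)` is exact for all `E` in `ℱ̃` and
all complexes `Y` with terms in `𝒞`, then `(ℱ̃, dg𝒞̃)` is a complete cotorsion pair cogenerated by
a set. -/
theorem isCompleteCotorsionPair_exactWithCyclesIn_dgRight [ℱ.IsClosedUnderIsomorphisms]
    (hperp : ∀ F C, ℱ F → 𝒞 C → ExtOneVanishes F C)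
    (hinj : HasEnoughInjectives ℱ 𝒞)
    (hepi : ∀ Z : A, ∃ (L : A) (q : L ⟶ Z), Epi q ∧ ℱ L)
    (hquot : ∀ {C D : A} (p : C ⟶ D) [Epi p], 𝒞 C → 𝒞 D)
    (hsum : ∀ C D : A, 𝒞 C → 𝒞 D → 𝒞 (C ⊞ D))
    (hext : ∀ {X Y Z : A} (f : X ⟶ Y) (g : Y ⟶ Z) (w : f ≫ g = 0),
      (ShortComplex.mk f g w).ShortExact → ℱ X → ℱ Z → ℱ Y)
    (hret : ∀ {X Y : A} (i : X ⟶ Y) (r : Y ⟶ X), i ≫ r = 𝟙 X → ℱ Y → ℱ X)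
    (hHom : ∀ E Y : CochainComplex A ℤ, exactWithCyclesIn ℱ E → (∀ n, 𝒞 (Y.X n)) →
      (HomComplex E Y).Acyclic)
    {I : Type u} (T : I → A) (hT : ∀ i, ℱ (T i))
    (hTC : rightPerp (ObjectProperty.ofObj T) = 𝒞) :
    IsCompleteCotorsionPair (exactWithCyclesIn ℱ) (dgRight ℱ 𝒞) ∧
      IsCogeneratedBySet.{u} (exactWithCyclesIn ℱ) (dgRight ℱ 𝒞) := by
  -- By `hHom` the exactness condition in the dg class is automatic.
  have hdg : ∀ Y, dgRight ℱ 𝒞 Y ↔ ∀ n, 𝒞 (Y.X n) :=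
    fun Y => ⟨fun h => h.1, fun h => ⟨h, fun E hE => hHom E Y hE h⟩⟩
  have hX : ∀ E, exactWithCyclesIn ℱ E → ∀ n, ℱ (E.X n) := fun E hE n => by
    obtain ⟨q, w, -, hS⟩ := exists_shortExact_cycles hE.1 n
    exact hext _ _ _ hS (hE.2 n) (hE.2 (n + 1))
  have perp : ∀ E Y, exactWithCyclesIn ℱ E → dgRight ℱ 𝒞 Y → ExtOneVanishes E Y :=
    fun E Y hE hY => extOneVanishes_of_homComplex_acyclic (hY.2 E hE)
      fun n => hperp _ _ (hX E hE n) (hY.1 n)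
  have emb := fun Z : CochainComplex A ℤ =>
    exists_diskSum_extension hperp hinj hquot hsum Z
  have inj : HasEnoughInjectives (exactWithCyclesIn ℱ) (dgRight ℱ 𝒞) := by
    intro Z
    obtain ⟨W, Q, i, p, w, hS, hW, hQ⟩ := emb Z
    exact ⟨W, diskSum Q, i, p, w, hS, (hdg W).2 hW, diskSum_mem Q hQ⟩
  have proj : HasEnoughProjectives (exactWithCyclesIn ℱ) (dgRight ℱ 𝒞) := by
    intro Z
    obtain ⟨Q, hQ⟩ := exists_family_succ (β := fun _ => A)
      (fun m b => ∃ (q : b ⟶ Z.X m), Epi q ∧ ℱ b) (fun m => hepi (Z.X m))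
    choose q hq hQ using hQ
    have hQ' : ∀ n, ℱ (Q n) := fun n => by
      obtain ⟨m, rfl⟩ : ∃ m, n = m + 1 := ⟨n - 1, by omega⟩
      exact hQ m
    obtain ⟨f, hf⟩ := exists_hom_from_diskSum Q q
    have : ∀ n, Epi (f.f n) := fun n => by
      have : Epi ((biprod.inl ≫ (diskSumXIso Q n).inv) ≫ f.f n) := by
        rw [Category.assoc, hf]; exact hq n
      exact epi_of_epi (biprod.inl ≫ (diskSumXIso Q n).inv) (f.f n)
    have : Epi f := HomologicalComplex.epi_of_epi_f _ inferInstance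
    have hK : (ShortComplex.mk (kernel.ι f) f (kernel.condition f)).ShortExact :=
      ShortComplex.ShortExact.mk' (ShortComplex.exact_kernel f) inferInstance this
    obtain ⟨W, Q₁, i, p, w, hS, hW, hQ₁⟩ := emb (kernel f)
    -- Salce's trick: the pushout of the two extensions of `kernel f` is an extension of `Z` by `W`,
    -- and also an extension of one sum of disks by another.
    have sq := IsPushout.of_hasPushout (kernel.ι f) i
    obtain ⟨a, wa, ha, -⟩ := exists_shortExact_of_isPushout hK sq
    obtain ⟨b, wb, hb, -⟩ := exists_shortExact_of_isPushout hS sq.flip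
    exact ⟨W, _, _, a, wa, ha, (hdg W).2 hW,
      exactWithCyclesIn_of_extension hext hb (diskSum_mem Q hQ') (diskSum_mem Q₁ hQ₁)⟩
  -- `Ext¹` against disks on `F` controls `Ext¹(F, Y.X n)`: embed `Y` in `W`, extend a map from `F`
  -- to a term of the cokernel to a map of complexes on the disks, lift it to `W`, and restrict to
  -- degree `n`.
  have lift : ∀ (F : A) (Y : CochainComplex A ℤ), ℱ F →
      ExtOneVanishes (diskSum fun _ => F) Y → ∀ n, ExtOneVanishes F (Y.X n) := by
    intro F Y hF hY n
    obtain ⟨W, Q, i, p, w, hS, hW, hQ⟩ := emb Y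
    refine extOneVanishes_of_lift (hperp _ _ hF (hW n))
      (hS.map_of_exact (HomologicalComplex.eval A (ComplexShape.up ℤ) n))
        fun (g : F ⟶ (diskSum Q).X n) => ?_
    obtain ⟨f, hf⟩ := exists_hom_from_diskSum (fun _ => F) (Z := diskSum Q)
      (Function.update (fun _ => 0) n g)
    obtain ⟨l, hl⟩ := hY.exists_lift hS f
    refine ⟨biprod.inl ≫ (diskSumXIso (fun _ => F) n).inv ≫ l.f n, ?_⟩
    have h1 := hf n
    rw [Function.update_self, ← hl] at h1
    exact (Category.assoc _ _ _).trans ((congrArg (biprod.inl ≫ ·) (Category.assoc _ _ _)).trans h1)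
  refine ⟨⟨⟨?_, ?_⟩, inj, proj⟩, I, fun i => diskSum fun _ => T i,
    fun i => diskSum_mem _ fun _ => hT i, ?_⟩
  · ext Y
    refine ⟨fun hY => (hdg Y).2 fun n => ?_, fun hY E hE => perp E Y hE hY⟩
    rw [← hTC]
    rintro _ ⟨i⟩
    exact lift _ _ (hT i) (hY _ (diskSum_mem _ fun _ => hT i)) n
  · ext X
    refine ⟨fun hX => ?_, fun hX Y hY => perp X Y hX hY⟩
    -- An object orthogonal to the right class is a retract of its approximation.
    obtain ⟨C, F, i, p, w, hS, hC, hF⟩ := proj X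
    obtain ⟨s⟩ := hX C hC F i p w hS
    exact exactWithCyclesIn_of_retract hret s.s p s.s_g hF
  · ext Y
    refine ⟨fun hY => (hdg Y).2 fun n => ?_, ?_⟩
    · rw [← hTC]
      rintro _ ⟨i⟩
      exact lift _ _ (hT i) (hY _ ⟨i⟩) n
    · rintro hY _ ⟨i⟩
      exact perp _ _ (diskSum_mem _ fun _ => hT i) hY

end Complexes

end CotorsionTheory

end CotorsionGeneral

/-! ### A well-order adapted to a locally finite relation. -/

section WellOrder

/-- If every element of `I` is assigned finitely many elements, then `I` has a well-order such that
each initial segment is, up to finitely many elements, closed under the assignment. -/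
lemma exists_wellOrder_of_finite_map {I : Type*} (c : I → Set I) (hc : ∀ i, (c i).Finite) :
    ∃ (_ : LinearOrder I) (_ : WellFoundedLT I), ∀ i : I, ∃ T : Set I,
      (∀ a ∈ T, ∀ b ∈ c a, b ∈ T) ∧ i ∉ T ∧ {a | a < i ∧ a ∉ T}.Finite := by
  classical
  let R : I → I → Prop := Relation.ReflTransGen fun x y => y ∈ c x
  have hcount : ∀ a, {b | R a b}.Countable := by
    intro a
    let S : ℕ → Finset I := fun n => Nat.rec {a} (fun _ s => s.biUnion fun i => (hc i).toFinset) n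
    refine (Set.countable_iUnion fun n => (S n).countable_toSet).mono ?_
    intro b hb
    induction hb with
    | refl => exact Set.mem_iUnion.2 ⟨0, by simp [S]⟩
    | tail _ h ih =>
      obtain ⟨n, hn⟩ := Set.mem_iUnion.1 ih
      exact Set.mem_iUnion.2 ⟨n + 1,
        Finset.mem_coe.2 (Finset.mem_biUnion.2 ⟨_, hn, (hc _).mem_toFinset.2 h⟩)⟩
  have henum : ∀ a, ∃ e : I → ℕ, Set.InjOn e {b | R a b} := fun a =>
    Set.countable_iff_exists_injOn.1 (hcount a)
  choose e he using henum
  let wf : WellFounded (WellOrderingRel : I → I → Prop) := WellOrderingRel.isWellOrder.wf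
  have hne : ∀ i, {a | R a i}.Nonempty := fun i => ⟨i, Relation.ReflTransGen.refl⟩
  -- An element is put in the block of the least element from which it can be reached. A block is
  -- countable, and following the relation never leads to a later block. Ordering first by block and
  -- then by an enumeration inside the block leaves only finitely many predecessors of `i` outside
  -- the earlier blocks, whose union is the required `T`.
  let block : I → I := fun i => wf.min {a | R a i} (hne i)
  have hblock : ∀ i, R (block i) i := fun i => wf.min_mem _ (hne i)
  have hmin : ∀ a i, R a i → ¬ WellOrderingRel a (block i) := fun a i h =>
    wf.not_lt_min {a | R a i} h
  let f : I → I × ℕ := fun i => (block i, e (block i) i)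
  have hf : Function.Injective f := by
    intro i j hij
    have h1 : block i = block j := congrArg Prod.fst hij
    have h2 : e (block i) i = e (block j) j := congrArg Prod.snd hij
    rw [← h1] at h2
    exact he (block i) (hblock i) (by rw [h1]; exact hblock j) h2
  let s : I × ℕ → I × ℕ → Prop := Prod.Lex WellOrderingRel (· < ·)
  let r : I → I → Prop := f ⁻¹'o s
  have hr : IsWellOrder I r := (RelEmbedding.preimage ⟨f, hf⟩ s).isWellOrder
  refine ⟨linearOrderOfSTO r, ⟨hr.wf⟩, fun i => ⟨{a | WellOrderingRel (block a) (block i)},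
    ?_, fun h => irrefl (r := WellOrderingRel) (block i) h, ?_⟩⟩
  · intro a ha b hb
    have hn := hmin (block a) b ((hblock a).tail hb)
    rcases trichotomous_of WellOrderingRel (block b) (block a) with h | h | h
    · exact trans_of WellOrderingRel h ha
    · exact (show WellOrderingRel (block b) (block i) by rw [h]; exact ha)
    · exact absurd h hn
  · refine Set.Finite.of_finite_image (f := e (block i))
      ((Set.finite_Iio (e (block i) i)).subset ?_)
      ((he (block i)).mono ?_)
    · rintro _ ⟨a, ⟨(ha : s (f a) (f i)), ha'⟩, rfl⟩
      rcases (Prod.lex_def).1 ha with h | ⟨h, h'⟩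
      · exact absurd h ha'
      · change e (block a) a < e (block i) i at h'
        have h : block a = block i := h
        rwa [h] at h'
    · rintro a ⟨(ha : s (f a) (f i)), ha'⟩
      rcases (Prod.lex_def).1 ha with h | ⟨h, h'⟩
      · exact absurd h ha'
      · have h : block a = block i := h
        have := hblock a
        rwa [h] at this

end WellOrder

/-! ### The Eilenberg swindle. -/

section Swindle

variable {R : Type*} [CommRing R]

/-- With `R^(M) ≅ M ⊕ K`, the sum of countably many copies is `M^(ℕ) ⊕ K^(ℕ)`, and `M^(ℕ)` absorbs
one more copy of `M`. -/
lemma Module.Free.exists_prod_of_projective {M : Type*} [AddCommGroup M] [Module R M]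
    [Module.Projective R M] : Module.Free R (M × (ℕ × M →₀ R)) := by
  obtain ⟨s, hs⟩ := Module.projective_def'.1 ‹Module.Projective R M›
  let p := Finsupp.linearCombination R (id : M → M)
  let K := LinearMap.ker p
  have hps : ∀ m, p (s m) = m := fun m => congr($hs m)
  let e₁ : (M →₀ R) ≃ₗ[R] M × K :=
    LinearEquiv.ofLinearMap
      (LinearMap.prod p ((LinearMap.id - s ∘ₗ p).codRestrict K fun x => by
        simp [K, hps]))
      (LinearMap.coprod s K.subtype)
      (by
        ext m <;> simp [hps])
      (by
        ext; simp)
  let e₂ : (ℕ →₀ (M × K)) ≃ₗ[R] (ℕ →₀ M) × (ℕ →₀ K) :=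
    LinearEquiv.ofLinearMap
      (LinearMap.prod (Finsupp.mapRange.linearMap (LinearMap.fst R M K))
        (Finsupp.mapRange.linearMap (LinearMap.snd R M K)))
      (LinearMap.coprod (Finsupp.mapRange.linearMap (LinearMap.inl R M K))
        (Finsupp.mapRange.linearMap (LinearMap.inr R M K)))
      (by ext <;> simp)
      (by ext <;> simp)
  let e₃ : (M × (ℕ →₀ M)) ≃ₗ[R] (ℕ →₀ M) :=
    ((Finsupp.uniqueLinearEquiv R M ()).symm.prodCongr (LinearEquiv.refl R _)).trans
      ((Finsupp.sumFinsuppLEquivProdFinsupp R).symm.trans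
        (Finsupp.domLCongr ((Equiv.sumComm _ _).trans Equiv.natSumPUnitEquivNat)))
  let e₄ : (ℕ × M →₀ R) ≃ₗ[R] (ℕ →₀ M) × (ℕ →₀ K) :=
    (Finsupp.curryLinearEquiv R).trans ((Finsupp.mapRange.linearEquiv e₁).trans e₂)
  let e₅ : (M × (ℕ × M →₀ R)) ≃ₗ[R] (ℕ × M →₀ R) :=
    ((LinearEquiv.refl R M).prodCongr e₄).trans
      ((LinearEquiv.prodAssoc R _ _ _).symm.trans
        ((e₃.prodCongr (LinearEquiv.refl R _)).trans e₄.symm))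
  exact Module.Free.of_equiv e₅.symm

end Swindle

/-! ### Localization at the powers of one element, for semilinear maps. -/

section Localization

/-- `φ : R → B` is the localization of the domain `R` at the powers of `x`. -/
structure IsChart {R B : Type*} [CommRing R] [CommRing B] (φ : R →+* B) (x : R) : Prop where
  isUnit : IsUnit (φ x)
  injective : Function.Injective φ
  surj (b : B) : ∃ (n : ℕ) (r : R), φ (x ^ n) * b = φ r

/-- `f : M → P` is a localization of the `R`-module `M` at the powers of `x`, where `P` is a module
over a ring in which `x` is invertible. -/
structure IsLoc {R B : Type*} [CommRing R] [CommRing B] (φ : R →+* B) (x : R) {M P : Type*}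
    [AddCommGroup M] [AddCommGroup P] [Module R M] [Module B P] (f : M →ₛₗ[φ] P) : Prop where
  surj (p : P) : ∃ (n : ℕ) (m : M), φ (x ^ n) • p = f m
  torsion (m : M) : f m = 0 → ∃ n : ℕ, x ^ n • m = 0

variable {R B : Type*} [CommRing R] [CommRing B] {φ : R →+* B} {x : R}
variable {M P N Q : Type*} [AddCommGroup M] [AddCommGroup P] [Module R M] [Module B P]
  [AddCommGroup N] [AddCommGroup Q] [Module R N] [Module B Q]

namespace IsChart

lemma isUnit_pow (hφ : IsChart φ x) (n : ℕ) : IsUnit (φ (x ^ n)) := by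
  rw [map_pow]; exact hφ.isUnit.pow n

lemma smul_pow_injective (hφ : IsChart φ x) (n : ℕ) {p q : P}
    (h : φ (x ^ n) • p = φ (x ^ n) • q) : p = q :=
  (hφ.isUnit_pow n).smul_left_cancel.1 h

lemma surj_finsupp (hφ : IsChart φ x) {I : Type*} (b : I →₀ B) :
    ∃ (n : ℕ) (r : I →₀ R), ∀ i, φ (x ^ n) * b i = φ (r i) := by
  classical
  induction b using Finsupp.induction with
  | zero => exact ⟨0, 0, by simp⟩
  | single_add i b f _ _ ih =>
    obtain ⟨n, r, hr⟩ := ih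
    obtain ⟨m, s, hs⟩ := hφ.surj b
    refine ⟨n + m, Finsupp.single i (x ^ n * s) + x ^ m • r, fun j => ?_⟩
    by_cases h : i = j
    · subst h
      simp only [Finsupp.add_apply, Finsupp.single_eq_same, Finsupp.smul_apply, smul_eq_mul,
        map_add, map_mul, ← hs, ← hr, pow_add]
      ring
    · simp only [Finsupp.add_apply, Finsupp.single_eq_of_ne' h, Finsupp.smul_apply, smul_eq_mul,
        map_mul, ← hr, pow_add, zero_add]
      ring

/-- Localization at `x` of a free module. -/
noncomputable def finsuppMap (φ : R →+* B) (I : Type*) : (I →₀ R) →ₛₗ[φ] (I →₀ B) where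
  toFun := Finsupp.mapRange φ (map_zero φ)
  map_add' := Finsupp.mapRange_add (map_add φ)
  map_smul' r f := by ext i; simp

lemma finsuppMap_apply (I : Type*) (f : I →₀ R) (i : I) : finsuppMap φ I f i = φ (f i) := rfl

lemma finsuppMap_single (I : Type*) (i : I) (r : R) :
    finsuppMap φ I (Finsupp.single i r) = Finsupp.single i (φ r) :=
  Finsupp.mapRange_single (hf := map_zero φ)

lemma isLoc_finsuppMap (hφ : IsChart φ x) (I : Type*) : IsLoc φ x (finsuppMap φ I) where
  surj p := by
    obtain ⟨n, r, hr⟩ := hφ.surj_finsupp p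
    exact ⟨n, r, Finsupp.ext hr⟩
  torsion m hm := ⟨0, by
    rw [pow_zero, one_smul]
    ext i
    exact hφ.injective (by simpa [finsuppMap_apply] using DFunLike.congr_fun hm i)⟩

end IsChart

namespace IsLoc

variable {f : M →ₛₗ[φ] P} {g : N →ₛₗ[φ] Q}

/-- The product of two semilinear maps. -/
def prodMapₛₗ (f : M →ₛₗ[φ] P) (g : N →ₛₗ[φ] Q) : M × N →ₛₗ[φ] P × Q where
  toFun m := (f m.1, g m.2)
  map_add' m n := by simp
  map_smul' r m := by simp

@[simp] lemma prodMapₛₗ_apply (f : M →ₛₗ[φ] P) (g : N →ₛₗ[φ] Q) (m : M × N) :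
    prodMapₛₗ f g m = (f m.1, g m.2) := rfl

lemma prodMap (hf : IsLoc φ x f) (hg : IsLoc φ x g) : IsLoc φ x (prodMapₛₗ f g) where
  surj p := by
    obtain ⟨n, a, ha⟩ := hf.surj p.1
    obtain ⟨m, b, hb⟩ := hg.surj p.2
    refine ⟨n + m, (x ^ m • a, x ^ n • b), Prod.ext ?_ ?_⟩
    · simp [← ha, pow_add, smul_smul, mul_comm]
    · simp [← hb, pow_add, smul_smul]
  torsion m hm := by
    obtain ⟨a, ha⟩ := hf.torsion m.1 (congrArg Prod.fst hm)
    obtain ⟨b, hb⟩ := hg.torsion m.2 (congrArg Prod.snd hm)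
    refine ⟨a + b, Prod.ext ?_ ?_⟩
    · simp [pow_add, mul_comm (x ^ a), mul_smul, ha]
    · simp [pow_add, mul_smul, hb]

lemma comp_equiv (hf : IsLoc φ x f) (e : P ≃ₗ[B] Q) :
    IsLoc φ x ((e : P →ₗ[B] Q).comp f) where
  surj q := by
    obtain ⟨n, m, hm⟩ := hf.surj (e.symm q)
    exact ⟨n, m, e.symm.injective (by simpa using hm)⟩
  torsion m hm := hf.torsion m (by simpa using hm)

lemma ext (hφ : IsChart φ x) (hf : IsLoc φ x f) {a b : P →ₗ[B] Q}
    (h : ∀ m, a (f m) = b (f m)) : a = b := by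
  ext p
  obtain ⟨n, m, hm⟩ := hf.surj p
  refine hφ.smul_pow_injective n ?_
  rw [← map_smul, ← map_smul, hm, h]

lemma exists_extend (hφ : IsChart φ x) (hf : IsLoc φ x f) (a : M →ₛₗ[φ] Q) :
    ∃ b : P →ₗ[B] Q, ∀ m, b (f m) = a m := by
  -- The value at `p` is required to be compatible with all fractions representing `p`; since `x`
  -- acts invertibly it is then unique, and linearity follows from uniqueness (`hu`).
  have h1 : ∀ p : P, ∃ q : Q, ∀ (n : ℕ) (m : M), φ (x ^ n) • p = f m → φ (x ^ n) • q = a m := by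
    intro p
    obtain ⟨n, m, hm⟩ := hf.surj p
    obtain ⟨u, hu⟩ := hφ.isUnit_pow n
    refine ⟨(↑u⁻¹ : B) • a m, fun n' m' hm' => ?_⟩
    have h2 : f (x ^ n • m' - x ^ n' • m) = 0 := by
      rw [map_sub, LinearMap.map_smulₛₗ, LinearMap.map_smulₛₗ, ← hm, ← hm', smul_smul, smul_smul,
        mul_comm, sub_self]
    obtain ⟨j, hj⟩ := hf.torsion _ h2
    have h3 := congrArg a hj
    rw [LinearMap.map_smulₛₗ, map_sub, LinearMap.map_smulₛₗ, LinearMap.map_smulₛₗ, map_zero] at h3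
    have h4 := sub_eq_zero.1 ((hφ.isUnit_pow j).smul_eq_zero.1 h3)
    refine hφ.smul_pow_injective n ?_
    rw [h4, smul_comm (φ (x ^ n)), ← hu, smul_smul (u : B), Units.mul_inv, one_smul]
  choose b hb using h1
  have hu : ∀ (p : P) (q : Q) (n : ℕ) (m : M), φ (x ^ n) • p = f m → φ (x ^ n) • q = a m →
      b p = q := fun p q n m h h' => hφ.smul_pow_injective n ((hb p n m h).trans h'.symm)
  refine ⟨{ toFun := b, map_add' := fun p q => ?_, map_smul' := fun c p => ?_ }, fun m => ?_⟩
  · obtain ⟨n, m, hm⟩ := hf.surj p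
    obtain ⟨n', m', hm'⟩ := hf.surj q
    refine hu _ _ (n + n') (x ^ n' • m + x ^ n • m') ?_ ?_
    · simp only [map_add, LinearMap.map_smulₛₗ, ← hm, ← hm', smul_smul, smul_add, pow_add, map_mul,
        mul_comm]
    · simp only [map_add, LinearMap.map_smulₛₗ, ← hb p n m hm, ← hb q n' m' hm', smul_smul,
        smul_add, pow_add, map_mul, mul_comm]
  · obtain ⟨n, m, hm⟩ := hf.surj p
    obtain ⟨n', r, hr⟩ := hφ.surj c
    refine hu _ _ (n' + n) (r • m) ?_ ?_
    · rw [LinearMap.map_smulₛₗ, ← hm, ← hr, smul_smul, smul_smul, pow_add, map_mul]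
      congr 1; ring
    · rw [LinearMap.map_smulₛₗ, ← hb p n m hm, ← hr, RingHom.id_apply, smul_smul, smul_smul,
        pow_add, map_mul]
      congr 1; ring
  · exact hu _ _ 0 m (by simp) (by simp)

/-- The localization of a basis. -/
lemma exists_basis (hφ : IsChart φ x) (hf : IsLoc φ x f) {I : Type*} (e : Module.Basis I R M) :
    ∃ b : Module.Basis I B P, ∀ i, b i = f (e i) := by
  have hsum : ∀ r : I →₀ R, f (Finsupp.linearCombination R e r) =
      Finsupp.linearCombination B (fun i => f (e i)) (IsChart.finsuppMap φ I r) := by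
    intro r
    induction r using Finsupp.induction_linear with
    | zero => simp
    | add r s hr hs => simp [hr, hs]
    | single i r => simp [IsChart.finsuppMap_single]
  have hli : LinearIndependent B fun i => f (e i) := by
    rw [linearIndependent_iff]
    intro c hc
    obtain ⟨n, r, hr⟩ := (hφ.isLoc_finsuppMap I).surj c
    have h1 : f (Finsupp.linearCombination R e r) = 0 := by
      rw [hsum, ← hr, map_smul, hc, smul_zero]
    obtain ⟨j, hj⟩ := hf.torsion _ h1
    rw [← map_smul, ← e.repr_symm_apply, LinearEquiv.map_eq_zero_iff] at hj
    refine hφ.smul_pow_injective n (hφ.smul_pow_injective j ?_)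
    rw [hr, ← LinearMap.map_smulₛₗ, hj, map_zero, smul_zero, smul_zero]
  refine ⟨Module.Basis.mk hli ?_, fun i => Module.Basis.mk_apply _ _ _⟩
  rintro p -
  obtain ⟨n, m, hm⟩ := hf.surj p
  obtain ⟨u, hu⟩ := hφ.isUnit_pow n
  have h1 : p = (↑u⁻¹ : B) • f m := by rw [← hm, ← hu, smul_smul, Units.inv_mul, one_smul]
  rw [h1, ← e.linearCombination_repr m, hsum]
  exact Submodule.smul_mem _ _ (by
    rw [← Finsupp.range_linearCombination]; exact ⟨_, rfl⟩)

end IsLoc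

end Localization

/-! ### Decomposing maps out of a locally projective sheaf. -/

section Decomposition

open scoped Polynomial LaurentPolynomial

namespace ProjLine

variable {k : Type u} [Field k]

lemma isChart_ιU : IsChart (ιU k) Polynomial.X where
  isUnit := isUnit_ιU_X k
  injective := Polynomial.toLaurent_injective
  surj := exists_ιU k

lemma isChart_ιV : IsChart (ιV k) Polynomial.X where
  isUnit := isUnit_ιV_X k
  injective := ιV_injective k
  surj b := by simpa using exists_ιV k 0 b

lemma ιV_X_pow (n : ℕ) : ιV k (Polynomial.X ^ n) = LaurentPolynomial.T (-n : ℤ) := by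
  rw [map_pow, ιV_X, LaurentPolynomial.T_pow, mul_neg_one]

/-- The Laurent polynomials of degree at most `m`. -/
def degreeLE (k : Type u) [Field k] (m : ℤ) : AddSubgroup k[T;T⁻¹] where
  carrier := {b | ∃ r : k[X], b = LaurentPolynomial.T m * ιV k r}
  add_mem' := by
    rintro _ _ ⟨r, rfl⟩ ⟨s, rfl⟩
    exact ⟨r + s, by rw [map_add, mul_add]⟩
  zero_mem' := ⟨0, by simp⟩
  neg_mem' := by
    rintro _ ⟨r, rfl⟩
    exact ⟨-r, by rw [map_neg, mul_neg]⟩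

lemma degreeLE_mono {m n : ℤ} (h : m ≤ n) : degreeLE k m ≤ degreeLE k n := by
  rintro _ ⟨r, rfl⟩
  obtain ⟨j, rfl⟩ := Int.le.dest h
  refine ⟨Polynomial.X ^ j * r, ?_⟩
  rw [map_mul, ιV_X_pow, ← mul_assoc, ← LaurentPolynomial.T_add]
  congr 2; ring

lemma exists_mem_degreeLE (b : k[T;T⁻¹]) : ∃ m, b ∈ degreeLE k m := by
  obtain ⟨j, q, hq⟩ := exists_ιV k 0 b
  refine ⟨j, q, ?_⟩
  rw [LaurentPolynomial.T_zero, one_mul, ιV_X_pow] at hq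
  rw [← hq, ← mul_assoc, ← LaurentPolynomial.T_add, add_neg_cancel, LaurentPolynomial.T_zero,
    one_mul]

lemma ιV_mul_mem_degreeLE {m : ℤ} (r : k[X]) {b : k[T;T⁻¹]} (h : b ∈ degreeLE k m) :
    ιV k r * b ∈ degreeLE k m := by
  obtain ⟨s, rfl⟩ := h
  exact ⟨r * s, by rw [map_mul, mul_left_comm]⟩

lemma exists_forall_mem_degreeLE {ι : Type*} (s : Finset ι) (b : ι → k[T;T⁻¹]) :
    ∃ m, ∀ i ∈ s, b i ∈ degreeLE k m := by
  choose m hm using fun i => exists_mem_degreeLE (b i)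
  obtain ⟨M, hM⟩ := (s.image m).bddAbove
  exact ⟨M, fun i hi => degreeLE_mono (hM (Finset.mem_coe.2 (Finset.mem_image_of_mem m hi))) (hm i)⟩

/-- A `k[x⁻¹]`-submodule of `k[x, x⁻¹]` that has bounded degree and contains a power of `x` is
generated by a power of `x`. -/
lemma exists_generator (S : AddSubgroup k[T;T⁻¹]) (hS : ∀ r : k[X], ∀ b ∈ S, ιV k r * b ∈ S)
    {M N : ℤ} (hM : S ≤ degreeLE k M) (hN : LaurentPolynomial.T N ∈ S) :
    ∃ m : ℤ, LaurentPolynomial.T m ∈ S ∧ S ≤ degreeLE k m := by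
  -- The bound on the degree gives `S = x^M a` for an ideal `a` of `k[x⁻¹]`. It contains a power of
  -- the variable, so its generator divides that power and is itself a power up to a unit.
  let a : Ideal k[X] :=
    { carrier := {r | LaurentPolynomial.T M * ιV k r ∈ S}
      add_mem' := fun {r s} hr hs => by
        have := S.add_mem hr hs
        rwa [← mul_add, ← map_add] at this
      zero_mem' := by simp [S.zero_mem]
      smul_mem' := fun r s hs => by
        have := hS r _ hs
        rwa [mul_left_comm, ← map_mul] at this }
  obtain ⟨j, hj⟩ : ∃ j : ℕ, (Polynomial.X ^ j : k[X]) ∈ a := by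
    refine ⟨(max (M - N) 0).toNat, ?_⟩
    change LaurentPolynomial.T M * ιV k _ ∈ S
    rw [ιV_X_pow, ← LaurentPolynomial.T_add, Int.toNat_of_nonneg (le_max_right _ _)]
    have := hS (Polynomial.X ^ (max (M - N) 0 - (M - N)).toNat) _ hN
    rw [ιV_X_pow, ← LaurentPolynomial.T_add, Int.toNat_of_nonneg (by simp)] at this
    convert this using 2
    ring
  obtain ⟨q, hq⟩ := (IsPrincipalIdealRing.principal a).principal
  have hqX : q ∣ Polynomial.X ^ j := by
    rw [hq] at hj
    exact Ideal.mem_span_singleton.1 hj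
  obtain ⟨i, -, hi⟩ := (dvd_prime_pow Polynomial.prime_X j).1 hqX
  have ha : a = Ideal.span {Polynomial.X ^ i} :=
    hq.trans (Ideal.span_singleton_eq_span_singleton.2 hi)
  have hT : ∀ r, LaurentPolynomial.T M * ιV k (Polynomial.X ^ i * r) =
      LaurentPolynomial.T (M - i) * ιV k r := fun r => by
    rw [map_mul, ιV_X_pow, ← mul_assoc, ← LaurentPolynomial.T_add, sub_eq_add_neg]
  refine ⟨M - i, ?_, fun b hb => ?_⟩
  · have h1 : Polynomial.X ^ i * 1 ∈ a := by
      rw [ha, mul_one]; exact Ideal.mem_span_singleton_self _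
    have h2 : LaurentPolynomial.T M * ιV k _ ∈ S := h1
    rwa [hT, map_one, mul_one] at h2
  · obtain ⟨r, rfl⟩ := hM hb
    have hr : r ∈ a := hb
    rw [ha] at hr
    obtain ⟨s, rfl⟩ := Ideal.mem_span_singleton.1 hr
    exact ⟨s, hT s⟩

section Core

variable {I J : Type*} {Y : Type*} [AddCommGroup Y] [Module k[T;T⁻¹] Y]

/-- The `k[x⁻¹]`-span of a basis of a `k[x, x⁻¹]`-module. -/
def latticeV {P : Type*} [AddCommGroup P] [Module k[T;T⁻¹] P] (e : Module.Basis J k[T;T⁻¹] P) :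
    AddSubgroup P where
  carrier := {w | ∀ j, ∃ r : k[X], e.repr w j = ιV k r}
  add_mem' := fun hv hw j => by
    obtain ⟨r, hr⟩ := hv j
    obtain ⟨s, hs⟩ := hw j
    exact ⟨r + s, by simp [hr, hs]⟩
  zero_mem' := fun j => ⟨0, by simp⟩
  neg_mem' := fun hv j => by
    obtain ⟨r, hr⟩ := hv j
    exact ⟨-r, by simp [hr]⟩

lemma smul_mem_latticeV {P : Type*} [AddCommGroup P] [Module k[T;T⁻¹] P]
    (e : Module.Basis J k[T;T⁻¹] P) (r : k[X]) {w : P} (hw : w ∈ latticeV e) :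
    ιV k r • w ∈ latticeV e := fun j => by
  obtain ⟨s, hs⟩ := hw j
  exact ⟨r * s, by simp [hs]⟩

lemma exists_smul_mem_latticeV {P : Type*} [AddCommGroup P] [Module k[T;T⁻¹] P]
    (e : Module.Basis J k[T;T⁻¹] P) (w : P) :
    ∃ n : ℕ, ιV k (Polynomial.X ^ n) • w ∈ latticeV e := by
  obtain ⟨n, r, hr⟩ := isChart_ιV.surj_finsupp (e.repr w)
  exact ⟨n, fun j => ⟨r j, by rw [← hr, map_smul]; rfl⟩⟩

/-- The standard basis spans the sections over `U`, and `latticeV e` the sections over `V`. The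
vectors `v` show that the quotient of consecutive steps of the filtration by initial segments of `I`
is `𝒪(m)`. The order must keep the leading coefficients at `i` of bounded degree, and this is where
finiteness up to a closed set enters. -/
lemma exists_leading_vectors (e : Module.Basis J k[T;T⁻¹] (I →₀ k[T;T⁻¹])) :
    ∃ (_ : LinearOrder I) (_ : WellFoundedLT I), ∀ i : I, ∃ (m : ℤ) (v : I →₀ k[T;T⁻¹]),
      v ∈ latticeV e ∧ (∀ a ∈ v.support, a ≤ i) ∧ v i = LaurentPolynomial.T m ∧
      ∀ w ∈ latticeV e, (∀ a ∈ w.support, a ≤ i) → w i ∈ degreeLE k m := by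
  classical
  -- An index `a` is related to all indices met when the standard vector at `a` is expanded in `e`
  -- and the vectors of `e` that occur are expanded back. A closed set of indices thus contains the
  -- supports of all the `e j` needed for its own standard vectors.
  obtain ⟨o, wf, h⟩ := exists_wellOrder_of_finite_map
    (fun i : I => ⋃ j ∈ (e.repr (Finsupp.single i 1)).support, ((e j).support : Set I))
    fun i => Set.Finite.biUnion (Finset.finite_toSet _) fun j _ => Finset.finite_toSet _
  refine ⟨o, wf, fun i => ?_⟩
  obtain ⟨T, hT, hiT, hfin⟩ := h i
  -- The possible leading coefficients at `i`, a `k[x⁻¹]`-submodule to which `exists_generator` will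
  -- apply.
  let S : AddSubgroup k[T;T⁻¹] :=
    { carrier := {b | ∃ w ∈ latticeV e, (∀ a ∈ w.support, a ≤ i) ∧ w i = b}
      add_mem' := by
        rintro _ _ ⟨v, hv, hv', rfl⟩ ⟨w, hw, hw', rfl⟩
        refine ⟨v + w, add_mem hv hw, fun a ha => ?_, rfl⟩
        rcases Finset.mem_union.1 (Finsupp.support_add ha) with ha | ha
        exacts [hv' a ha, hw' a ha]
      zero_mem' := ⟨0, zero_mem _, by simp, rfl⟩
      neg_mem' := by
        rintro _ ⟨v, hv, hv', rfl⟩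
        exact ⟨-v, neg_mem hv, fun a ha => hv' a (by simpa using ha), rfl⟩ }
  have hS : ∀ r : k[X], ∀ b ∈ S, ιV k r * b ∈ S := by
    rintro r _ ⟨v, hv, hv', rfl⟩
    exact ⟨ιV k r • v, smul_mem_latticeV e r hv,
      fun a ha => hv' a (Finsupp.support_smul ha), rfl⟩
  obtain ⟨N, hN⟩ := exists_smul_mem_latticeV e (Finsupp.single i 1)
  have hNS : LaurentPolynomial.T (-N : ℤ) ∈ S := by
    refine ⟨_, hN, fun a ha => ?_, ?_⟩
    · have := Finsupp.support_smul ha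
      exact (Finset.mem_singleton.1 (Finsupp.support_single_subset this)).le
    · simp [ιV_X_pow]
  -- only finitely many basis vectors `e j` contribute to the coefficient at `i`
  let F : Finset J := (hfin.insert i).toFinset.biUnion fun a =>
    (e.repr (Finsupp.single a 1)).support
  obtain ⟨M, hM⟩ := exists_forall_mem_degreeLE F fun j => e j i
  have hSM : S ≤ degreeLE k M := by
    rintro _ ⟨w, hw, hw', rfl⟩
    have h1 : w i = (e.repr w).sum fun j b => b * e j i := by
      conv_lhs => rw [← e.linearCombination_repr w]
      rw [Finsupp.linearCombination_apply, Finsupp.sum_apply]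
      rfl
    rw [h1]
    refine sum_mem fun j hj => ?_
    obtain ⟨r, hr⟩ := hw j
    simp only [hr]
    by_cases hjF : j ∈ F
    · exact ιV_mul_mem_degreeLE r (hM j hjF)
    -- A vector `e j` outside `F` can only come from a standard vector with index in `T`; its
    -- support then lies in `T`, so it contributes nothing at `i`.
    have h2 : ∃ a ∈ T, j ∈ (e.repr (Finsupp.single a 1)).support := by
      by_contra! hc
      have h3 : e.repr w = w.sum fun a b => b • e.repr (Finsupp.single a 1) := by
        conv_lhs => rw [← Finsupp.sum_single w]
        rw [Finsupp.sum, map_sum]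
        refine Finset.sum_congr rfl fun a _ => ?_
        dsimp only
        rw [← map_smul, Finsupp.smul_single, smul_eq_mul, mul_one]
      rw [Finsupp.mem_support_iff, h3, Finsupp.sum_apply] at hj
      refine hj (Finset.sum_eq_zero fun a ha => ?_)
      have h4 : e.repr (Finsupp.single a 1) j = 0 := by
        rw [← Finsupp.notMem_support_iff]
        by_cases haT : a ∈ T
        · exact hc a haT
        · intro hj'
          refine hjF (Finset.mem_biUnion.2 ⟨a, ?_, hj'⟩)
          rcases (hw' a ha).lt_or_eq with h | h
          · exact (Set.Finite.mem_toFinset _).2 (Set.mem_insert_of_mem i ⟨h, haT⟩)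
          · exact (Set.Finite.mem_toFinset _).2 (Or.inl h)
      simp [h4]
    obtain ⟨a, haT, ha⟩ := h2
    have h5 : e j i = 0 := by
      rw [← Finsupp.notMem_support_iff]
      exact fun hi => hiT (hT a haT i (Set.mem_biUnion ha hi))
    rw [h5, mul_zero]
    exact zero_mem _
  obtain ⟨m, ⟨v, hv, hv', hvi⟩, hm⟩ := exists_generator S hS hSM hNS
  exact ⟨m, v, hv, hv', hvi, fun w hw hw' => hm ⟨w, hw, hw', rfl⟩⟩

/-- In the application `H` and `G` are the images in `Y_B` of the sections over `U` and `V`, and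
`hHG` is the vanishing of `H¹` for all twists. -/
lemma exists_decomposition_finsupp (e : Module.Basis J k[T;T⁻¹] (I →₀ k[T;T⁻¹]))
    (H G : AddSubgroup Y) (hG : ∀ r : k[X], ∀ y ∈ G, ιV k r • y ∈ G)
    (hHG : ∀ (n : ℤ) (y : Y), ∃ h ∈ H, y - (LaurentPolynomial.T n : k[T;T⁻¹]) • h ∈ G)
    (φ : (I →₀ k[T;T⁻¹]) →ₗ[k[T;T⁻¹]] Y) :
    ∃ ψ : (I →₀ k[T;T⁻¹]) →ₗ[k[T;T⁻¹]] Y,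
      (∀ i, ψ (Finsupp.single i 1) ∈ H) ∧ ∀ w ∈ latticeV e, φ w - ψ w ∈ G := by
  classical
  obtain ⟨o, wf, h⟩ := exists_leading_vectors e
  choose m v hv hvle hvi hlead using h
  choose s hs hs' using hHG
  -- The value of `ψ` at the `i`-th basis vector is chosen, given the earlier values, so that `φ -
  -- ψ` takes `v i` into `G`. As the leading coefficient of `v i` is `x^(m i)`, this is an instance
  -- of `hHG`.
  let step : ∀ i : I, (∀ a : I, a < i → Y) → Y := fun i ih =>
    s (m i) (φ (v i) - ∑ a ∈ (v i).support, if ha : a < i then v i a • ih a ha else 0)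
  let α : I → Y := wf.wf.fix step
  have hα : ∀ i, α i = s (m i) (φ (v i) - ∑ a ∈ (v i).support, if a < i then v i a • α a else 0) :=
    fun i => wf.wf.fix_eq step i
  let ψ := Finsupp.linearCombination k[T;T⁻¹] α
  have hψv : ∀ i, φ (v i) - ψ (v i) ∈ G := fun i => by
    have h1 : ψ (v i) = (∑ a ∈ (v i).support, if a < i then v i a • α a else 0) +
        (LaurentPolynomial.T (m i) : k[T;T⁻¹]) • α i := by
      have hmem : i ∈ (v i).support := by
        rw [Finsupp.mem_support_iff, hvi]
        exact (LaurentPolynomial.isUnit_T _).ne_zero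
      simp only [ψ, Finsupp.linearCombination_apply, Finsupp.sum]
      rw [← Finset.sum_erase_add _ _ hmem, ← Finset.sum_erase_add _ _ hmem, if_neg (lt_irrefl i),
        add_zero, hvi]
      congr 1
      refine Finset.sum_congr rfl fun a ha => ?_
      rw [if_pos (lt_of_le_of_ne (hvle i a (Finset.mem_of_mem_erase ha))
        (Finset.ne_of_mem_erase ha))]
    rw [h1, ← sub_sub, hα i]
    exact hs' _ _
  -- Division with remainder: subtracting a `k[x⁻¹]`-multiple of `v i` removes the leading term, and
  -- well-founded induction handles the rest.
  have key : ∀ i, ∀ w ∈ latticeV e, (∀ a ∈ w.support, a ≤ i) → φ w - ψ w ∈ G := by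
    intro i
    induction i using wf.wf.induction with
    | _ i ih =>
    intro w hw hwi
    obtain ⟨r, hr⟩ := hlead i w hw hwi
    let w' := w - ιV k r • v i
    have hw' : w' ∈ latticeV e := sub_mem hw (smul_mem_latticeV e r (hv i))
    have h2 : φ w' - ψ w' ∈ G := by
      by_cases h0 : w' = 0
      · rw [h0, map_zero, map_zero, sub_zero]; exact zero_mem _
      have hne := Finsupp.support_nonempty_iff.2 h0
      refine ih (w'.support.max' hne) ?_ w' hw' fun a ha => Finset.le_max' _ _ ha
      have hmem := w'.support.max'_mem hne
      refine lt_of_le_of_ne ?_ fun heq => ?_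
      · rcases Finset.mem_union.1 (Finsupp.support_sub hmem) with h | h
        · exact hwi _ h
        · exact hvle i _ (Finsupp.support_smul h)
      · rw [heq, Finsupp.mem_support_iff] at hmem
        refine hmem ?_
        simp only [w', Finsupp.sub_apply, Finsupp.smul_apply, smul_eq_mul, hvi, hr]
        ring
    have h3 := add_mem h2 (hG r _ (hψv i))
    simp only [w', map_sub, map_smul, smul_sub] at h3
    convert h3 using 1
    abel
  refine ⟨ψ, fun i => ?_, fun w hw => ?_⟩
  · simp only [ψ, Finsupp.linearCombination_single, one_smul]
    rw [hα]
    exact hs _ _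
  · by_cases h0 : w = 0
    · rw [h0, map_zero, map_zero, sub_zero]; exact zero_mem _
    exact key (w.support.max' (Finsupp.support_nonempty_iff.2 h0)) w hw
      fun a ha => Finset.le_max' _ _ ha

variable {M N P : Type*} [AddCommGroup M] [AddCommGroup N] [AddCommGroup P] [Module k[X] M]
  [Module k[X] N] [Module k[T;T⁻¹] P] {f : M →ₛₗ[ιU k] P} {g : N →ₛₗ[ιV k] P}

lemma exists_decomposition_of_free [Module.Free k[X] M] [Module.Free k[X] N]
    (hf : IsLoc (ιU k) Polynomial.X f) (hg : IsLoc (ιV k) Polynomial.X g)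
    (H G : AddSubgroup Y) (hH : ∀ r : k[X], ∀ y ∈ H, ιU k r • y ∈ H)
    (hG : ∀ r : k[X], ∀ y ∈ G, ιV k r • y ∈ G)
    (hHG : ∀ (n : ℤ) (y : Y), ∃ h ∈ H, y - (LaurentPolynomial.T n : k[T;T⁻¹]) • h ∈ G)
    (φ : P →ₗ[k[T;T⁻¹]] Y) :
    ∃ ψ : P →ₗ[k[T;T⁻¹]] Y, (∀ m, ψ (f m) ∈ H) ∧ ∀ n, φ (g n) - ψ (g n) ∈ G := by
  let bM := Module.Free.chooseBasis k[X] M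
  let bN := Module.Free.chooseBasis k[X] N
  obtain ⟨eU, heU⟩ := hf.exists_basis isChart_ιU bM
  obtain ⟨eV, heV⟩ := hg.exists_basis isChart_ιV bN
  obtain ⟨ψ, hψ, hψ'⟩ := exists_decomposition_finsupp (eV.map eU.repr) H G hG hHG
    (φ ∘ₗ (eU.repr.symm : _ →ₗ[k[T;T⁻¹]] P))
  refine ⟨ψ ∘ₗ (eU.repr : P →ₗ[k[T;T⁻¹]] _), fun m => ?_, fun n => ?_⟩
  · have key : ∀ r, ψ (eU.repr (f (Finsupp.linearCombination k[X] bM r))) ∈ H := by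
      intro r
      induction r using Finsupp.induction_linear with
      | zero => simp [zero_mem]
      | add r s hr hs => simpa using add_mem hr hs
      | single i r =>
        rw [Finsupp.linearCombination_single, LinearMap.map_smulₛₗ, ← heU, map_smul, map_smul,
          eU.repr_self]
        exact hH r _ (hψ i)
    simpa using key (bM.repr m)
  · have key : ∀ r, eU.repr (g (Finsupp.linearCombination k[X] bN r)) ∈
        latticeV (eV.map eU.repr) := by
      intro r
      induction r using Finsupp.induction_linear with
      | zero => simp [zero_mem]
      | add r s hr hs => simpa using add_mem hr hs
      | single j r =>
        rw [Finsupp.linearCombination_single, LinearMap.map_smulₛₗ, ← heV, map_smul]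
        refine smul_mem_latticeV _ r fun i => ?_
        classical
        refine ⟨if j = i then 1 else 0, ?_⟩
        simp only [Module.Basis.map_repr, LinearEquiv.trans_apply, LinearEquiv.symm_apply_apply,
          Module.Basis.repr_self, Finsupp.single_apply]
        split_ifs <;> simp
    have h1 := hψ' _ (key (bN.repr n))
    simpa using h1

/-- Adding a trivial sheaf of large rank makes the sections over both charts free by the swindle;
`φ` is extended by zero and the result is restricted to the original summand. -/
lemma exists_decomposition [Module.Projective k[X] M] [Module.Projective k[X] N]
    (hf : IsLoc (ιU k) Polynomial.X f) (hg : IsLoc (ιV k) Polynomial.X g)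
    (H G : AddSubgroup Y) (hH : ∀ r : k[X], ∀ y ∈ H, ιU k r • y ∈ H)
    (hG : ∀ r : k[X], ∀ y ∈ G, ιV k r • y ∈ G)
    (hHG : ∀ (n : ℤ) (y : Y), ∃ h ∈ H, y - (LaurentPolynomial.T n : k[T;T⁻¹]) • h ∈ G)
    (φ : P →ₗ[k[T;T⁻¹]] Y) :
    ∃ ψ : P →ₗ[k[T;T⁻¹]] Y, (∀ m, ψ (f m) ∈ H) ∧ ∀ n, φ (g n) - ψ (g n) ∈ G := by
  let S := (ℕ × M) ⊕ (ℕ × N)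
  have := Module.Free.exists_prod_of_projective (R := k[X]) (M := M)
  have := Module.Free.exists_prod_of_projective (R := k[X]) (M := N)
  have : Module.Free k[X] (M × (S →₀ k[X])) := Module.Free.of_equiv
    ((LinearEquiv.prodAssoc k[X] M (ℕ × M →₀ k[X]) (ℕ × N →₀ k[X])).trans
      ((LinearEquiv.refl _ M).prodCongr (Finsupp.sumFinsuppLEquivProdFinsupp k[X]).symm))
  have : Module.Free k[X] (N × (S →₀ k[X])) := Module.Free.of_equiv
    ((LinearEquiv.prodAssoc k[X] N (ℕ × N →₀ k[X]) (ℕ × M →₀ k[X])).trans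
      ((LinearEquiv.refl _ N).prodCongr ((Finsupp.sumFinsuppLEquivProdFinsupp k[X]).symm.trans
        (Finsupp.domLCongr (Equiv.sumComm _ _)))))
  obtain ⟨ψ, h1, h2⟩ := exists_decomposition_of_free
    (hf.prodMap (isChart_ιU.isLoc_finsuppMap S)) (hg.prodMap (isChart_ιV.isLoc_finsuppMap S))
    H G hH hG hHG (φ ∘ₗ LinearMap.fst _ _ _)
  refine ⟨ψ ∘ₗ LinearMap.inl _ _ _, fun m => ?_, fun n => ?_⟩
  · simpa using h1 (m, 0)
  · simpa using h2 (n, 0)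

end Core

end ProjLine

end Decomposition

/-! ### Sections, gluing and exactness for sheaves on the projective line. -/

section Sheaves

open CategoryTheory CategoryTheory.Limits Opposite ZeroObject
open scoped Polynomial LaurentPolynomial

namespace ProjLine

noncomputable section

variable {k : Type u} [Field k]

namespace Rep

/-- The map `M → P` of `M → P ← N` as a semilinear map. -/
def rU (F : Rep k) : F.onU →ₛₗ[ιU k] F.onUV where
  toFun m := F.resU.hom m
  map_add' m n := map_add F.resU.hom m n
  map_smul' r m := F.resU.hom.map_smul r m

/-- The map `N → P` of `M → P ← N` as a semilinear map. -/
def rV (F : Rep k) : F.onV →ₛₗ[ιV k] F.onUV where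
  toFun m := F.resV.hom m
  map_add' m n := map_add F.resV.hom m n
  map_smul' r m := F.resV.hom.map_smul r m

lemma isQuasicoherent_iff (F : Rep k) : IsQuasicoherent F ↔
    IsLoc (ιU k) Polynomial.X F.rU ∧ IsLoc (ιV k) Polynomial.X F.rV := by
  refine and_congr ?_ ?_
  · rw [isLocalizedModule_powers_iff _ _ (isUnit_restrictScalars _ (isUnit_ιU_X k) _)]
    exact ⟨fun h => ⟨h.1, h.2⟩, fun h => ⟨h.1, h.2⟩⟩
  · rw [isLocalizedModule_powers_iff _ _ (isUnit_restrictScalars _ (isUnit_ιV_X k) _)]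
    exact ⟨fun h => ⟨h.1, h.2⟩, fun h => ⟨h.1, h.2⟩⟩

/-- Constructor for morphisms of representations. -/
def homMk {F G : Rep k} (a : F.onU ⟶ G.onU) (b : F.onV ⟶ G.onV) (c : F.onUV ⟶ G.onUV)
    (hU : ∀ m, c.hom (F.rU m) = G.rU (a.hom m)) (hV : ∀ m, c.hom (F.rV m) = G.rV (b.hom m)) :
    F ⟶ G where
  app X := match X with
    | op none => c
    | op (some WalkingPair.left) => a
    | op (some WalkingPair.right) => b
  naturality {X Y} f := by
    obtain ⟨X⟩ := X
    obtain ⟨Y⟩ := Y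
    obtain ⟨f, rfl⟩ : ∃ f' : Y ⟶ X, f'.op = f := ⟨f.unop, rfl⟩
    rcases f with _ | (_ | _)
    · change F.map (𝟙 _) ≫ _ = _ ≫ G.map (𝟙 _)
      rw [PresheafOfModules.map_id, PresheafOfModules.map_id]
      ext m
      rfl
    · ext m
      exact hU m
    · ext m
      exact hV m

end Rep

namespace Qco

lemma isLocU (F : Qco k) : IsLoc (ιU k) Polynomial.X F.obj.rU :=
  ((Rep.isQuasicoherent_iff _).1 F.property).1

lemma isLocV (F : Qco k) : IsLoc (ιV k) Polynomial.X F.obj.rV :=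
  ((Rep.isQuasicoherent_iff _).1 F.property).2

instance : PreservesFiniteLimits (Rep.IsQuasicoherent (k := k)).ι :=
  have := fun {X Y : Qco k} (f : X ⟶ Y) =>
    ObjectProperty.preservesKernels_ι (Rep.IsQuasicoherent (k := k)) f
  Functor.preservesFiniteLimits_of_preservesKernels _

instance : PreservesFiniteColimits (Rep.IsQuasicoherent (k := k)).ι :=
  have := fun {X Y : Qco k} (f : X ⟶ Y) =>
    ObjectProperty.preservesCokernels_ι (Rep.IsQuasicoherent (k := k)) f
  Functor.preservesFiniteColimits_of_preservesCokernels _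

variable (k) in
/-- Sections over `U`. -/
def evU : Qco k ⥤ ModuleCat.{u} k[X] :=
  (Rep.IsQuasicoherent (k := k)).ι ⋙ PresheafOfModules.evaluation _ (op WalkingSpan.left)

variable (k) in
/-- Sections over `V`. -/
def evV : Qco k ⥤ ModuleCat.{u} k[X] :=
  (Rep.IsQuasicoherent (k := k)).ι ⋙ PresheafOfModules.evaluation _ (op WalkingSpan.right)

variable (k) in
/-- Sections over `U ∩ V`. -/
def evB : Qco k ⥤ ModuleCat.{u} k[T;T⁻¹] :=
  (Rep.IsQuasicoherent (k := k)).ι ⋙ PresheafOfModules.evaluation _ (op WalkingSpan.zero)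

instance : (evU k).Additive where
  map_add := rfl
instance : (evV k).Additive where
  map_add := rfl
instance : (evB k).Additive where
  map_add := rfl
instance : PreservesFiniteLimits (evU k) :=
  comp_preservesFiniteLimits _ (PresheafOfModules.evaluation (structureRings k)
    (op WalkingSpan.left))
instance : PreservesFiniteColimits (evU k) :=
  comp_preservesFiniteColimits _ (PresheafOfModules.evaluation (structureRings k)
    (op WalkingSpan.left))
instance : PreservesFiniteLimits (evV k) :=
  comp_preservesFiniteLimits _ (PresheafOfModules.evaluation (structureRings k)
    (op WalkingSpan.right))
instance : PreservesFiniteColimits (evV k) :=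
  comp_preservesFiniteColimits _ (PresheafOfModules.evaluation (structureRings k)
    (op WalkingSpan.right))
instance : PreservesFiniteLimits (evB k) :=
  comp_preservesFiniteLimits _ (PresheafOfModules.evaluation (structureRings k)
    (op WalkingSpan.zero))
instance : PreservesFiniteColimits (evB k) :=
  comp_preservesFiniteColimits _ (PresheafOfModules.evaluation (structureRings k)
    (op WalkingSpan.zero))

/-- The restriction of sections from `U` to `U ∩ V`. -/
def rU (F : Qco k) : (evU k).obj F →ₛₗ[ιU k] (evB k).obj F := F.obj.rU

/-- The restriction of sections from `V` to `U ∩ V`. -/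
def rV (F : Qco k) : (evV k).obj F →ₛₗ[ιV k] (evB k).obj F := F.obj.rV

lemma isLoc_rU (F : Qco k) : IsLoc (ιU k) Polynomial.X F.rU := F.isLocU
lemma isLoc_rV (F : Qco k) : IsLoc (ιV k) Polynomial.X F.rV := F.isLocV

section Morphisms

variable {F G H : Qco k}

lemma evB_map_rU (f : F ⟶ G) (m : (evU k).obj F) :
    ((evB k).map f).hom (F.rU m) = G.rU (((evU k).map f).hom m) := Rep.natU f.hom m

lemma evB_map_rV (f : F ⟶ G) (m : (evV k).obj F) :
    ((evB k).map f).hom (F.rV m) = G.rV (((evV k).map f).hom m) := Rep.natV f.hom m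

lemma exists_hom (a : (evU k).obj F ⟶ (evU k).obj G) (b : (evV k).obj F ⟶ (evV k).obj G)
    (c : (evB k).obj F ⟶ (evB k).obj G) (hU : ∀ m, c.hom (F.rU m) = G.rU (a.hom m))
    (hV : ∀ m, c.hom (F.rV m) = G.rV (b.hom m)) :
    ∃ f : F ⟶ G, (evU k).map f = a ∧ (evV k).map f = b ∧ (evB k).map f = c :=
  ⟨ObjectProperty.homMk (Rep.homMk (F := F.obj) (G := G.obj) a b c hU hV), rfl, rfl, rfl⟩

lemma evB_hom_ext {c d : (evB k).obj F ⟶ (evB k).obj G}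
    (h : ∀ m, c.hom (F.rU m) = d.hom (F.rU m)) : c = d :=
  ModuleCat.hom_ext (F.isLoc_rU.ext isChart_ιU h)

lemma evB_hom_ext' {c d : (evB k).obj F ⟶ (evB k).obj G}
    (h : ∀ m, c.hom (F.rV m) = d.hom (F.rV m)) : c = d :=
  ModuleCat.hom_ext (F.isLoc_rV.ext isChart_ιV h)

lemma hom_ext {f g : F ⟶ G} (hU : (evU k).map f = (evU k).map g)
    (hV : (evV k).map f = (evV k).map g) : f = g := by
  have hB : (evB k).map f = (evB k).map g := evB_hom_ext fun m => by
    rw [evB_map_rU, evB_map_rU, hU]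
  apply ObjectProperty.hom_ext
  apply PresheafOfModules.hom_ext
  rintro ⟨_ | (_ | _)⟩
  exacts [hB, hU, hV]

lemma exists_extendU (a : (evU k).obj F ⟶ (evU k).obj G) :
    ∃ c : (evB k).obj F ⟶ (evB k).obj G, ∀ m, c.hom (F.rU m) = G.rU (a.hom m) := by
  obtain ⟨c, hc⟩ := F.isLoc_rU.exists_extend isChart_ιU (G.rU.comp a.hom)
  exact ⟨ModuleCat.ofHom c, hc⟩

lemma exists_extendV (a : (evV k).obj F ⟶ (evV k).obj G) :
    ∃ c : (evB k).obj F ⟶ (evB k).obj G, ∀ m, c.hom (F.rV m) = G.rV (a.hom m) := by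
  obtain ⟨c, hc⟩ := F.isLoc_rV.exists_extend isChart_ιV (G.rV.comp a.hom)
  exact ⟨ModuleCat.ofHom c, hc⟩

/-- The localization of a map of sections over `U`. -/
def locU (a : (evU k).obj F ⟶ (evU k).obj G) : (evB k).obj F ⟶ (evB k).obj G :=
  (exists_extendU a).choose

/-- The localization of a map of sections over `V`. -/
def locV (a : (evV k).obj F ⟶ (evV k).obj G) : (evB k).obj F ⟶ (evB k).obj G :=
  (exists_extendV a).choose

lemma locU_rU (a : (evU k).obj F ⟶ (evU k).obj G) (m : (evU k).obj F) :
    (locU a).hom (F.rU m) = G.rU (a.hom m) := (exists_extendU a).choose_spec m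

lemma locV_rV (a : (evV k).obj F ⟶ (evV k).obj G) (m : (evV k).obj F) :
    (locV a).hom (F.rV m) = G.rV (a.hom m) := (exists_extendV a).choose_spec m

lemma locU_add (a b : (evU k).obj F ⟶ (evU k).obj G) : locU (a + b) = locU a + locU b :=
  evB_hom_ext fun m => by simp [locU_rU]

lemma locV_add (a b : (evV k).obj F ⟶ (evV k).obj G) : locV (a + b) = locV a + locV b :=
  evB_hom_ext' fun m => by simp [locV_rV]

lemma locU_map (f : F ⟶ G) : locU ((evU k).map f) = (evB k).map f :=
  evB_hom_ext fun m => by rw [locU_rU, evB_map_rU]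

lemma locV_map (f : F ⟶ G) : locV ((evV k).map f) = (evB k).map f :=
  evB_hom_ext' fun m => by rw [locV_rV, evB_map_rV]

lemma locU_comp (a : (evU k).obj F ⟶ (evU k).obj G) (b : (evU k).obj G ⟶ (evU k).obj H) :
    locU (a ≫ b) = locU a ≫ locU b :=
  evB_hom_ext fun m => by simp [locU_rU]

lemma locV_comp (a : (evV k).obj F ⟶ (evV k).obj G) (b : (evV k).obj G ⟶ (evV k).obj H) :
    locV (a ≫ b) = locV a ≫ locV b :=
  evB_hom_ext' fun m => by simp [locV_rV]

lemma exists_glue (a : (evU k).obj F ⟶ (evU k).obj G) (b : (evV k).obj F ⟶ (evV k).obj G)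
    (h : locU a = locV b) : ∃ f : F ⟶ G, (evU k).map f = a ∧ (evV k).map f = b := by
  obtain ⟨f, h1, h2, -⟩ := exists_hom a b (locU a) (locU_rU a) (by rw [h]; exact locV_rV b)
  exact ⟨f, h1, h2⟩

lemma mono_of_ev (f : F ⟶ G) (hU : Mono ((evU k).map f)) (hV : Mono ((evV k).map f)) : Mono f where
  right_cancellation g h w := hom_ext
    (by rw [← cancel_mono ((evU k).map f), ← Functor.map_comp, w, Functor.map_comp])
    (by rw [← cancel_mono ((evV k).map f), ← Functor.map_comp, w, Functor.map_comp])

lemma epi_of_ev (f : F ⟶ G) (hU : Epi ((evU k).map f)) (hV : Epi ((evV k).map f)) : Epi f where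
  left_cancellation g h w := hom_ext
    (by rw [← cancel_epi ((evU k).map f), ← Functor.map_comp, w, Functor.map_comp])
    (by rw [← cancel_epi ((evV k).map f), ← Functor.map_comp, w, Functor.map_comp])

lemma isZero_of_ev (F : Qco k) (hU : IsZero ((evU k).obj F)) (hV : IsZero ((evV k).obj F)) :
    IsZero F := by
  rw [IsZero.iff_id_eq_zero]
  exact hom_ext (hU.eq_of_src _ _) (hV.eq_of_src _ _)

lemma exact_of_ev (S : ShortComplex (Qco k)) (hU : (S.map (evU k)).Exact)
    (hV : (S.map (evV k)).Exact) : S.Exact := by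
  rw [ShortComplex.exact_iff_isZero_homology] at hU hV ⊢
  exact isZero_of_ev _ (hU.of_iso (S.mapHomologyIso (evU k)).symm)
    (hV.of_iso (S.mapHomologyIso (evV k)).symm)

lemma shortExact_of_ev (S : ShortComplex (Qco k)) (hU : (S.map (evU k)).ShortExact)
    (hV : (S.map (evV k)).ShortExact) : S.ShortExact :=
  ShortComplex.ShortExact.mk' (exact_of_ev S hU.exact hV.exact)
    (mono_of_ev _ hU.mono_f hV.mono_f) (epi_of_ev _ hU.epi_g hV.epi_g)

end Morphisms

section Constructions

/-- The sheaf with given modules of sections and restriction maps. -/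
def ofMaps {M N P : Type u} [AddCommGroup M] [AddCommGroup N] [AddCommGroup P] [Module k[X] M]
    [Module k[X] N] [Module k[T;T⁻¹] P] (f : M →ₛₗ[ιU k] P) (g : N →ₛₗ[ιV k] P)
    (hf : IsLoc (ιU k) Polynomial.X f) (hg : IsLoc (ιV k) Polynomial.X g) : Qco k where
  obj := Rep.mk (ModuleCat.of k[X] M) (ModuleCat.of k[X] N) (ModuleCat.of k[T;T⁻¹] P)
    (ModuleCat.ofHom (Y := (ModuleCat.restrictScalars (ιU k)).obj (ModuleCat.of k[T;T⁻¹] P))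
      { toFun := f, map_add' := map_add f, map_smul' := f.map_smulₛₗ })
    (ModuleCat.ofHom (Y := (ModuleCat.restrictScalars (ιV k)).obj (ModuleCat.of k[T;T⁻¹] P))
      { toFun := g, map_add' := map_add g, map_smul' := g.map_smulₛₗ })
  property := (Rep.isQuasicoherent_iff _).2 ⟨hf, hg⟩

variable (Y Q : Qco k) (θ : (evB k).obj Q →ₗ[k[T;T⁻¹]] (evB k).obj Y)

/-- The extension of `Q` by `Y` whose restriction map from `U` is sheared by `θ`. -/
def shear : Qco k :=
  ofMaps (((LinearEquiv.refl k[T;T⁻¹] ((evB k).obj Q)).skewProd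
      (LinearEquiv.refl k[T;T⁻¹] ((evB k).obj Y)) θ : _ →ₗ[k[T;T⁻¹]] _).comp
        (IsLoc.prodMapₛₗ Q.rU Y.rU)) (IsLoc.prodMapₛₗ Q.rV Y.rV)
    (IsLoc.comp_equiv (Q.isLoc_rU.prodMap Y.isLoc_rU) _) (Q.isLoc_rV.prodMap Y.isLoc_rV)

lemma shear_rU (q : (evU k).obj Q) (y : (evU k).obj Y) :
    (shear Y Q θ).rU (q, y) = (Q.rU q, Y.rU y + θ (Q.rU q)) := rfl

lemma shear_rV (q : (evV k).obj Q) (y : (evV k).obj Y) :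
    (shear Y Q θ).rV (q, y) = (Q.rV q, Y.rV y) := rfl

/-- The inclusion of the second factor of a product of modules. -/
def inrHom {R : Type u} [CommRing R] (N M : ModuleCat.{u} R) : M ⟶ ModuleCat.of R (N × M) :=
  ModuleCat.ofHom (LinearMap.inr R N M)

/-- The projection to the first factor of a product of modules. -/
def fstHom {R : Type u} [CommRing R] (N M : ModuleCat.{u} R) : ModuleCat.of R (N × M) ⟶ N :=
  ModuleCat.ofHom (LinearMap.fst R N M)

lemma shortExact_prod {R : Type u} [CommRing R] (M N : ModuleCat.{u} R)
    {f : M ⟶ ModuleCat.of R (N × M)} {g : ModuleCat.of R (N × M) ⟶ N} (w : f ≫ g = 0)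
    (hf : ∀ m, f.hom m = (0, m)) (hg : ∀ n, g.hom n = n.1) :
    (ShortComplex.mk f g w).ShortExact := by
  refine ShortComplex.ShortExact.mk' ?_ ?_ ?_
  · rw [ShortComplex.ShortExact.moduleCat_exact_iff_function_exact]
    rintro ⟨n, m⟩
    constructor
    · intro h
      have h : n = 0 := (hg _).symm.trans h
      exact ⟨m, by rw [h]; exact hf m⟩
    · rintro ⟨m', h⟩
      refine (hg _).trans ?_
      rw [← h]
      exact congrArg Prod.fst (hf m')
  · rw [ModuleCat.mono_iff_injective]
    intro m m' h
    have h : f.hom m = f.hom m' := h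
    rw [hf, hf] at h
    exact congrArg Prod.snd h
  · rw [ModuleCat.epi_iff_surjective]
    exact fun n => ⟨(n, 0), hg _⟩

lemma exists_shortExact_shear : ∃ (i : Y ⟶ shear Y Q θ) (p : shear Y Q θ ⟶ Q) (w : i ≫ p = 0),
    (ShortComplex.mk i p w).ShortExact ∧ (∀ x, ((evU k).map p).hom x = x.1) ∧
      ∀ x, ((evV k).map p).hom x = x.1 := by
  obtain ⟨i, hi, hi', -⟩ := exists_hom (F := Y) (G := shear Y Q θ)
    (inrHom ((evU k).obj Q) ((evU k).obj Y)) (inrHom ((evV k).obj Q) ((evV k).obj Y))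
    (inrHom ((evB k).obj Q) ((evB k).obj Y))
    (fun m => by
      change ((0, Y.rU m) : (evB k).obj Q × (evB k).obj Y) = (Q.rU 0, Y.rU m + θ (Q.rU 0))
      simp)
    (fun m => by
      change ((0, Y.rV m) : (evB k).obj Q × (evB k).obj Y) = (Q.rV 0, Y.rV m)
      simp)
  obtain ⟨p, hp, hp', -⟩ := exists_hom (F := shear Y Q θ) (G := Q)
    (fstHom ((evU k).obj Q) ((evU k).obj Y)) (fstHom ((evV k).obj Q) ((evV k).obj Y))
    (fstHom ((evB k).obj Q) ((evB k).obj Y))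
    (fun m => rfl) (fun m => rfl)
  have w : i ≫ p = 0 := hom_ext
    (by rw [Functor.map_comp, hi, hp, Functor.map_zero]; rfl)
    (by rw [Functor.map_comp, hi', hp', Functor.map_zero]; rfl)
  refine ⟨i, p, w, shortExact_of_ev _ ?_ ?_, fun x => by rw [hp]; rfl, fun x => by rw [hp']; rfl⟩
  · exact shortExact_prod ((evU k).obj Y) ((evU k).obj Q) _ (fun m => by
      change ((evU k).map i).hom m = _; rw [hi]; rfl) (fun m => by
      change ((evU k).map p).hom m = _; rw [hp]; rfl)
  · exact shortExact_prod ((evV k).obj Y) ((evV k).obj Q) _ (fun m => by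
      change ((evV k).map i).hom m = _; rw [hi']; rfl) (fun m => by
      change ((evV k).map p).hom m = _; rw [hp']; rfl)

end Constructions

end Qco
end
end ProjLine
end Sheaves

/-! ### The class `𝒰^⊥` and its orthogonality to locally projective sheaves. -/

section TwistAcyclic

open CategoryTheory CategoryTheory.Limits
open scoped Polynomial LaurentPolynomial

namespace ProjLine

noncomputable section

variable {k : Type u} [Field k]

namespace Qco

lemma locU_sub {F G : Qco k} (a b : (evU k).obj F ⟶ (evU k).obj G) :
    locU (a - b) = locU a - locU b :=
  evB_hom_ext fun m => by simp [locU_rU]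

lemma locallyProjective_iff (F : Qco k) : locallyProjective k F ↔
    Projective ((evU k).obj F) ∧ Projective ((evB k).obj F) ∧ Projective ((evV k).obj F) :=
  and_congr (IsProjective.iff_projective (R := k[X]) ((evU k).obj F)) (and_congr
    (IsProjective.iff_projective (R := k[T;T⁻¹]) ((evB k).obj F))
    (IsProjective.iff_projective (R := k[X]) ((evV k).obj F)))

lemma projective_of_retract {C : Type*} [Category C] {X Y : C} (i : X ⟶ Y) (r : Y ⟶ X)
    (h : i ≫ r = 𝟙 X) (hY : Projective Y) : Projective X :=
  (Retract.mk i r h).projective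

lemma projective_of_shortExact {C : Type*} [Category C] [Abelian C] {S : ShortComplex C}
    (hS : S.ShortExact) (h1 : Projective S.X₁) (h3 : Projective S.X₃) : Projective S.X₂ :=
  Projective.of_iso hS.splittingOfProjective.isoBinaryBiproduct.symm inferInstance

lemma locallyProjective_of_retract {F G : Qco k} (i : F ⟶ G) (r : G ⟶ F) (h : i ≫ r = 𝟙 F)
    (hG : locallyProjective k G) : locallyProjective k F := by
  rw [locallyProjective_iff] at hG ⊢
  exact ⟨projective_of_retract ((evU k).map i) ((evU k).map r)
      (by rw [← Functor.map_comp, h, CategoryTheory.Functor.map_id]) hG.1,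
    projective_of_retract ((evB k).map i) ((evB k).map r)
      (by rw [← Functor.map_comp, h, CategoryTheory.Functor.map_id]) hG.2.1,
    projective_of_retract ((evV k).map i) ((evV k).map r)
      (by rw [← Functor.map_comp, h, CategoryTheory.Functor.map_id]) hG.2.2⟩

instance : (locallyProjective k).IsClosedUnderIsomorphisms where
  of_iso e h := locallyProjective_of_retract e.inv e.hom e.inv_hom_id h

lemma locallyProjective_of_shortExact {F G H : Qco k} (f : F ⟶ G) (g : G ⟶ H) (w : f ≫ g = 0)
    (hS : (ShortComplex.mk f g w).ShortExact) (hF : locallyProjective k F)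
    (hH : locallyProjective k H) : locallyProjective k G := by
  rw [locallyProjective_iff] at hF hH ⊢
  exact ⟨projective_of_shortExact (hS.map_of_exact (evU k)) hF.1 hH.1,
    projective_of_shortExact (hS.map_of_exact (evB k)) hF.2.1 hH.2.1,
    projective_of_shortExact (hS.map_of_exact (evV k)) hF.2.2 hH.2.2⟩

lemma locallyProjective_ofMaps {M N P : Type u} [AddCommGroup M] [AddCommGroup N]
    [AddCommGroup P] [Module k[X] M] [Module k[X] N] [Module k[T;T⁻¹] P] (f : M →ₛₗ[ιU k] P)
    (g : N →ₛₗ[ιV k] P) (hf : IsLoc (ιU k) Polynomial.X f) (hg : IsLoc (ιV k) Polynomial.X g)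
    [hM : Module.Projective k[X] M] [hN : Module.Projective k[X] N]
    [hP : Module.Projective k[T;T⁻¹] P] : locallyProjective k (ofMaps f g hf hg) :=
  ⟨hM, hP, hN⟩

variable (k) in
lemma locallyProjective_twist (n : ℤ) : locallyProjective k (twist k n) :=
  ⟨inferInstanceAs (Module.Projective k[X] k[X]),
    inferInstanceAs (Module.Projective k[T;T⁻¹] k[T;T⁻¹]),
    inferInstanceAs (Module.Projective k[X] k[X])⟩

variable (k) in
/-- The sheaves `Y` with `H¹(Y(n)) = 0` for all `n`. -/
def twistAcyclic : ObjectProperty (Qco k) := fun Y =>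
  ∀ (n : ℤ) (y : (evB k).obj Y), ∃ (a : (evU k).obj Y) (b : (evV k).obj Y),
    y = (LaurentPolynomial.T n : k[T;T⁻¹]) • Y.rU a + Y.rV b

lemma twistAcyclic_of_epi {Y Z : Qco k} (p : Y ⟶ Z) [Epi p] (hY : twistAcyclic k Y) :
    twistAcyclic k Z := fun n z => by
  obtain ⟨y, rfl⟩ := (ModuleCat.epi_iff_surjective ((evB k).map p)).1 inferInstance z
  obtain ⟨a, b, rfl⟩ := hY n y
  refine ⟨((evU k).map p).hom a, ((evV k).map p).hom b, ?_⟩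
  rw [← evB_map_rU, ← evB_map_rV]
  exact (map_add ((evB k).map p).hom _ _).trans
    (congrArg (· + _) (map_smul ((evB k).map p).hom _ _))

lemma twistAcyclic_biprod {Y Z : Qco k} (hY : twistAcyclic k Y) (hZ : twistAcyclic k Z) :
    twistAcyclic k (Y ⊞ Z) := fun n x => by
  obtain ⟨a, b, h⟩ := hY n (((evB k).map biprod.fst).hom x)
  obtain ⟨a', b', h'⟩ := hZ n (((evB k).map biprod.snd).hom x)
  have key : x = ((evB k).map (biprod.inl : Y ⟶ Y ⊞ Z)).hom (((evB k).map biprod.fst).hom x) +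
      ((evB k).map (biprod.inr : Z ⟶ Y ⊞ Z)).hom (((evB k).map biprod.snd).hom x) := by
    have := congr((($((evB k).congr_map (biprod.total (X := Y) (Y := Z)))).hom x))
    rw [Functor.map_add, Functor.map_comp, Functor.map_comp, CategoryTheory.Functor.map_id] at this
    exact this.symm
  refine ⟨((evU k).map biprod.inl).hom a + ((evU k).map biprod.inr).hom a',
    ((evV k).map biprod.inl).hom b + ((evV k).map biprod.inr).hom b', ?_⟩
  rw [map_add, map_add, ← evB_map_rU, ← evB_map_rV, ← evB_map_rU, ← evB_map_rV, smul_add,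
    key, h, h']
  simp only [map_add, map_smul]
  abel

/-- The map `θ` is a Čech cocycle, realized by the extension `shear Y Q θ`. The second components of
a splitting over `U` and over `V` write it as a coboundary. -/
lemma exists_decomposition_of_extOneVanishes {Q Y : Qco k}
    (h : CotorsionTheory.ExtOneVanishes Q Y) (θ : (evB k).obj Q →ₗ[k[T;T⁻¹]] (evB k).obj Y) :
    ∃ (a : (evU k).obj Q ⟶ (evU k).obj Y) (b : (evV k).obj Q ⟶ (evV k).obj Y),
      (locU a + locV b).hom = θ := by
  obtain ⟨i, p, w, hS, hpU, hpV⟩ := exists_shortExact_shear Y Q θ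
  obtain ⟨σ⟩ := h _ i p w hS
  obtain ⟨s, hs⟩ : ∃ s : Q ⟶ shear Y Q θ, s ≫ p = 𝟙 Q := ⟨σ.s, σ.s_g⟩
  let sU : (evU k).obj Q →ₗ[k[X]] (evU k).obj Q × (evU k).obj Y := ((evU k).map s).hom
  let sV : (evV k).obj Q →ₗ[k[X]] (evV k).obj Q × (evV k).obj Y := ((evV k).map s).hom
  let sB : (evB k).obj Q →ₗ[k[T;T⁻¹]] (evB k).obj Q × (evB k).obj Y := ((evB k).map s).hom
  have h1 : ∀ x, (sU x).1 = x := fun x => by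
    have := congr((($((evU k).congr_map hs)).hom x))
    rw [Functor.map_comp, CategoryTheory.Functor.map_id] at this
    exact (hpU _).symm.trans this
  have h2 : ∀ x, (sV x).1 = x := fun x => by
    have := congr((($((evV k).congr_map hs)).hom x))
    rw [Functor.map_comp, CategoryTheory.Functor.map_id] at this
    exact (hpV _).symm.trans this
  have h3 : ∀ x, (sB (Q.rU x)).2 = Y.rU (sU x).2 + θ (Q.rU x) := fun x => by
    have : sB (Q.rU x) = (Q.rU (sU x).1, Y.rU (sU x).2 + θ (Q.rU (sU x).1)) := evB_map_rU s x
    rw [this, h1]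
  have h4 : ∀ x, (sB (Q.rV x)).2 = Y.rV (sV x).2 := fun x => by
    have : sB (Q.rV x) = (Q.rV (sV x).1, Y.rV (sV x).2) := evB_map_rV s x
    rw [this]
  let a : (evU k).obj Q ⟶ (evU k).obj Y := ModuleCat.ofHom
    (-(LinearMap.snd k[X] ((evU k).obj Q) ((evU k).obj Y) ∘ₗ sU))
  let b : (evV k).obj Q ⟶ (evV k).obj Y := ModuleCat.ofHom
    (LinearMap.snd k[X] ((evV k).obj Q) ((evV k).obj Y) ∘ₗ sV)
  let c : (evB k).obj Q ⟶ (evB k).obj Y := ModuleCat.ofHom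
    (LinearMap.snd k[T;T⁻¹] ((evB k).obj Q) ((evB k).obj Y) ∘ₗ sB)
  have hb : locV b = c := evB_hom_ext' fun m => by
    rw [locV_rV]
    exact (h4 m).symm
  have ha : locU a = ModuleCat.ofHom θ - c := evB_hom_ext fun m => by
    rw [locU_rU]
    change Y.rU (-(sU m).2) = θ (Q.rU m) - (sB (Q.rU m)).2
    rw [h3, map_neg]
    abel
  refine ⟨a, b, ?_⟩
  rw [ha, hb, sub_add_cancel]
  rfl

lemma twistAcyclic_of_twistPerp {Y : Qco k} (hY : twistPerp k Y) : twistAcyclic k Y :=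
    fun n y => by
  -- This map sends `xⁿ` to `y`, and `xⁿ` is both the image of the generator over `V` and `xⁿ` times
  -- the image of the generator over `U`.
  let θ : k[T;T⁻¹] →ₗ[k[T;T⁻¹]] (evB k).obj Y :=
    LinearMap.toSpanSingleton _ _ ((LaurentPolynomial.T (-n) : k[T;T⁻¹]) • y)
  obtain ⟨a, b, hab⟩ := exists_decomposition_of_extOneVanishes
    (hY _ (ObjectProperty.ofObj_apply _ n)) θ
  have hT : (LaurentPolynomial.T n : k[T;T⁻¹]) * LaurentPolynomial.T (-n) = 1 := by
    rw [← LaurentPolynomial.T_add, add_neg_cancel, LaurentPolynomial.T_zero]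
  obtain ⟨u, hu⟩ : ∃ u : (evU k).obj (twist k n), (twist k n).rU u = (1 : k[T;T⁻¹]) :=
    ⟨(1 : k[X]), map_one (ιU k)⟩
  obtain ⟨v, hv⟩ : ∃ v : (evV k).obj (twist k n),
      (twist k n).rV v = (LaurentPolynomial.T n : k[T;T⁻¹]) :=
    ⟨(1 : k[X]), (congrArg (LaurentPolynomial.T n * ·) (map_one (ιV k))).trans (mul_one _)⟩
  have huv : (LaurentPolynomial.T n : k[T;T⁻¹]) • (twist k n).rU u = (twist k n).rV v := by
    rw [hu, hv]
    exact mul_one (LaurentPolynomial.T n : k[T;T⁻¹])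
  refine ⟨a.hom u, b.hom v, ?_⟩
  rw [← locU_rU, ← locV_rV, ← map_smul, huv, ← LinearMap.add_apply, ← ModuleCat.hom_add, hab, hv]
  change y = (LaurentPolynomial.T n : k[T;T⁻¹]) • (LaurentPolynomial.T (-n) : k[T;T⁻¹]) • y
  rw [smul_smul, hT, one_smul]

lemma exists_lift_of_range {R B : Type u} [CommRing R] [CommRing B] {φ : R →+* B}
    {M N : ModuleCat.{u} R} {Y : Type u} [AddCommGroup Y] [Module B Y] [Projective M]
    (f : M →ₛₗ[φ] Y) (g : N →ₛₗ[φ] Y) (h : ∀ m, ∃ n, g n = f m) :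
    ∃ a : M ⟶ N, ∀ m, g (a.hom m) = f m := by
  let _ : Module R Y := Module.compHom Y φ
  let f' : M →ₗ[R] Y := { toFun := f, map_add' := map_add f, map_smul' := f.map_smulₛₗ }
  let g' : N →ₗ[R] Y := { toFun := g, map_add' := map_add g, map_smul' := g.map_smulₛₗ }
  have : Module.Projective R M := (IsProjective.iff_projective (R := R) M).2 inferInstance
  let f'' : M →ₗ[R] LinearMap.range g' := f'.codRestrict _ h
  obtain ⟨a, ha⟩ := Module.projective_lifting_property g'.rangeRestrict f''
    g'.surjective_rangeRestrict
  exact ⟨ModuleCat.ofHom a, fun m => congrArg Subtype.val (LinearMap.congr_fun ha m)⟩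

/-- The decomposition at the level of images lifts to maps into the sections themselves because the
sections of `V` over each chart are projective. -/
lemma exists_locU_add_locV {V Y : Qco k} (hV : locallyProjective k V) (hY : twistAcyclic k Y)
    (c : (evB k).obj V ⟶ (evB k).obj Y) :
    ∃ (a : (evU k).obj V ⟶ (evU k).obj Y) (b : (evV k).obj V ⟶ (evV k).obj Y),
      c = locU a + locV b := by
  have hV' := (locallyProjective_iff V).1 hV
  have := hV'.1
  have := hV'.2.2
  have p1 : Module.Projective k[X] ((evU k).obj V) := hV.1
  have p2 : Module.Projective k[X] ((evV k).obj V) := hV.2.2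
  obtain ⟨ψ, h1, h2⟩ := exists_decomposition V.isLoc_rU V.isLoc_rV
    (AddMonoidHom.range Y.rU.toAddMonoidHom) (AddMonoidHom.range Y.rV.toAddMonoidHom)
    (by rintro r _ ⟨m, rfl⟩; exact ⟨(r • m :), Y.rU.map_smulₛₗ r m⟩)
    (by rintro r _ ⟨m, rfl⟩; exact ⟨(r • m :), Y.rV.map_smulₛₗ r m⟩)
    (fun n y => by
      obtain ⟨a, b, rfl⟩ := hY n y
      exact ⟨_, ⟨a, rfl⟩, b, (add_sub_cancel_left _ _).symm⟩) c.hom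
  obtain ⟨a, ha⟩ := exists_lift_of_range (ψ.comp V.rU) Y.rU h1
  obtain ⟨b, hb⟩ := exists_lift_of_range ((c.hom - ψ).comp V.rV) Y.rV h2
  refine ⟨a, b, ?_⟩
  have ha' : locU a = ModuleCat.ofHom ψ := evB_hom_ext fun m => by rw [locU_rU, ha]; rfl
  have hb' : locV b = c - ModuleCat.ofHom ψ := evB_hom_ext' fun m => by rw [locV_rV, hb]; rfl
  rw [ha', hb', add_sub_cancel]

/-- Sections of the extension exist over each chart by projectivity. Their difference on the
intersection is a map to `Y`; decomposing it corrects the local sections until they agree. -/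
lemma extOneVanishes_of_twistAcyclic {V Y : Qco k} (hV : locallyProjective k V)
    (hY : twistAcyclic k Y) : CotorsionTheory.ExtOneVanishes V Y := by
  intro E i p w hS
  obtain ⟨pU, -, pV⟩ := (locallyProjective_iff V).1 hV
  have hB := hS.map_of_exact (evB k)
  have : Epi p := hS.epi_g
  let sU := Projective.factorThru (𝟙 ((evU k).obj V)) ((evU k).map p)
  let sV := Projective.factorThru (𝟙 ((evV k).obj V)) ((evV k).map p)
  have hsU : sU ≫ (evU k).map p = (evU k).map (𝟙 V) := by
    rw [CategoryTheory.Functor.map_id]; exact Projective.factorThru_comp _ _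
  have hsV : sV ≫ (evV k).map p = (evV k).map (𝟙 V) := by
    rw [CategoryTheory.Functor.map_id]; exact Projective.factorThru_comp _ _
  have hd : (locU sU - locV sV) ≫ (evB k).map p = 0 := by
    rw [Preadditive.sub_comp]
    nth_rw 1 [← locU_map]
    rw [← locV_map, ← locU_comp, ← locV_comp, hsU, hsV, locU_map, locV_map, sub_self]
  have := hB.mono_f
  obtain ⟨c, hc⟩ : ∃ c : (evB k).obj V ⟶ (evB k).obj Y, c ≫ (evB k).map i = locU sU - locV sV :=
    ⟨hB.exact.lift _ hd, hB.exact.lift_f _ hd⟩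
  obtain ⟨a, b, rfl⟩ := exists_locU_add_locV hV hY c
  obtain ⟨s, h1, h2⟩ := exists_glue (sU - a ≫ (evU k).map i) (sV + b ≫ (evV k).map i) (by
    rw [locU_sub, locV_add, locU_comp, locV_comp, locU_map, locV_map, sub_eq_iff_eq_add,
      add_assoc, ← Preadditive.add_comp, add_comm (locV b), hc]
    abel)
  have hs : s ≫ p = 𝟙 V := by
    refine hom_ext ?_ ?_
    · rw [Functor.map_comp, h1, Preadditive.sub_comp, Category.assoc, ← Functor.map_comp, w, hsU]
      simp
    · rw [Functor.map_comp, h2, Preadditive.add_comp, Category.assoc, ← Functor.map_comp, w, hsV]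
      simp
  have := hS.mono_f
  exact ⟨ShortComplex.Splitting.ofExactOfSection _ hS.exact s hs inferInstance⟩

variable (k) in
lemma twistPerp_eq : twistPerp k = twistAcyclic k :=
  funext fun Y => propext ⟨twistAcyclic_of_twistPerp, fun hY V hV => by
    obtain ⟨n⟩ := hV
    exact extOneVanishes_of_twistAcyclic (locallyProjective_twist k n) hY⟩

end Qco

end

end ProjLine

end TwistAcyclic

/-! ### Free sheaves and approximation sequences of sheaves. -/

section FreeSheaves

open CategoryTheory CategoryTheory.Limits
open scoped Polynomial LaurentPolynomial

namespace ProjLine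

noncomputable section

variable {k : Type u} [Field k]

namespace Qco

/-- The automorphism of a free module that multiplies the `i`-th basis vector by `x ^ n i`. -/
def diagT {I : Type u} (n : I → ℤ) : (I →₀ k[T;T⁻¹]) ≃ₗ[k[T;T⁻¹]] (I →₀ k[T;T⁻¹]) :=
  Finsupp.basisSingleOne.equiv
    (Finsupp.basisSingleOne.unitsSMul fun i => (LaurentPolynomial.isUnit_T (R := k) (n i)).unit)
    (Equiv.refl I)

lemma diagT_single {I : Type u} (n : I → ℤ) (i : I) :
    diagT n (Finsupp.single i 1) =
      (LaurentPolynomial.T (n i) : k[T;T⁻¹]) • Finsupp.single i (1 : k[T;T⁻¹]) := by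
  have h := Module.Basis.equiv_apply (b := Finsupp.basisSingleOne (R := k[T;T⁻¹]) (ι := I)) (i := i)
    (Finsupp.basisSingleOne.unitsSMul fun i => (LaurentPolynomial.isUnit_T (R := k) (n i)).unit)
    (Equiv.refl I)
  rw [Equiv.refl_apply, Module.Basis.unitsSMul_apply, Finsupp.coe_basisSingleOne] at h
  exact h

variable {I : Type u} (e : (I →₀ k[T;T⁻¹]) ≃ₗ[k[T;T⁻¹]] (I →₀ k[T;T⁻¹])) (n : I → ℤ)

/-- The sheaf with free modules of sections over `U` and `V` and transition matrix given by `e`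
and the monomials `x ^ n i`. -/
def free : Qco k :=
  ofMaps (e.toLinearMap.comp (IsChart.finsuppMap (ιU k) I))
    ((diagT (k := k) n).toLinearMap.comp (IsChart.finsuppMap (ιV k) I))
    ((isChart_ιU.isLoc_finsuppMap I).comp_equiv e)
    ((isChart_ιV.isLoc_finsuppMap I).comp_equiv (diagT n))

lemma locallyProjective_free : locallyProjective k (free e n) :=
  locallyProjective_ofMaps _ _ _ _

/-- The basis of the sections over `U` of a free sheaf. -/
def freeU (i : I) : (evU k).obj (free e n) := (Finsupp.single i 1 : I →₀ k[X])

/-- The basis of the sections over `V` of a free sheaf. -/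
def freeV (i : I) : (evV k).obj (free e n) := (Finsupp.single i 1 : I →₀ k[X])

/-- The basis of the sections over `U ∩ V` of a free sheaf. -/
def freeB (i : I) : (evB k).obj (free e n) := (Finsupp.single i 1 : I →₀ k[T;T⁻¹])

lemma rU_freeU (i : I) : (free e n).rU (freeU e n i) = e (Finsupp.single i 1) := by
  change e (IsChart.finsuppMap (ιU k) I (Finsupp.single i 1)) = _
  rw [IsChart.finsuppMap_single, map_one]

lemma rV_freeV (i : I) : (free e n).rV (freeV e n i) =
    (LaurentPolynomial.T (n i) : k[T;T⁻¹]) • freeB e n i := by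
  change diagT n (IsChart.finsuppMap (ιV k) I (Finsupp.single i 1)) = _
  rw [IsChart.finsuppMap_single, map_one]
  exact diagT_single n i

/-- The map from a free module that sends the basis to a given family of vectors. -/
def homOfVectors {R : Type u} [CommRing R] {M : ModuleCat.{u} R} (a : I → M) :
    ModuleCat.of R (I →₀ R) ⟶ M :=
  ModuleCat.ofHom (Finsupp.linearCombination R a)

lemma homOfVectors_single {R : Type u} [CommRing R] {M : ModuleCat.{u} R} (a : I → M) (i : I) :
    (homOfVectors a).hom (Finsupp.single i 1 : I →₀ R) = a i :=
  (Finsupp.linearCombination_single R (1 : R) i).trans (one_smul _ _)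

lemma exists_hom_of_free {Z : Qco k} (a : I → (evU k).obj Z) (b : I → (evV k).obj Z)
    (h : ∀ i, (LaurentPolynomial.T (n i) : k[T;T⁻¹]) • Z.rU (a i) = Z.rV (b i)) :
    ∃ q : free (LinearEquiv.refl _ _) n ⟶ Z,
      (∀ i, ((evU k).map q).hom (freeU _ _ i) = a i) ∧
        ∀ i, ((evV k).map q).hom (freeV _ _ i) = b i := by
  let α : (evU k).obj (free (LinearEquiv.refl _ _) n) ⟶ (evU k).obj Z := homOfVectors a
  let β : (evV k).obj (free (LinearEquiv.refl _ _) n) ⟶ (evV k).obj Z := homOfVectors b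
  have hα : ∀ i, α.hom (freeU _ _ i) = a i := homOfVectors_single a
  have hβ : ∀ i, β.hom (freeV _ _ i) = b i := homOfVectors_single b
  have key : ∀ i, (locU α).hom (freeB _ _ i) = (locV β).hom (freeB _ _ i) := fun i => by
    apply (LaurentPolynomial.isUnit_T (R := k) (n i)).smul_left_cancel.1
    have h1 : (locU α).hom (freeB _ _ i) = Z.rU (a i) := by
      rw [← hα, ← locU_rU, rU_freeU]
      rfl
    rw [h1, h, ← hβ, ← locV_rV, rV_freeV, map_smul]
  obtain ⟨q, h1, h2⟩ := exists_glue α β (ModuleCat.hom_ext (by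
    have : ∀ f g : (I →₀ k[T;T⁻¹]) →ₗ[k[T;T⁻¹]] (evB k).obj Z,
        (∀ i, f (Finsupp.single i 1) = g (Finsupp.single i 1)) → f = g :=
      fun f g hfg => Finsupp.basisSingleOne.ext fun i => by simpa using hfg i
    exact this _ _ key))
  exact ⟨q, by rw [h1]; exact hα, by rw [h2]; exact hβ⟩

lemma exists_epi_locallyProjective (Z : Qco k) :
    ∃ (L : Qco k) (q : L ⟶ Z), Epi q ∧ locallyProjective k L := by
  -- An element is a map from some `𝒪(n)` to `Z`. These maps suffice, since a section over one chart
  -- extends to the other after multiplication by a power of the coordinate.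
  let I := {t : ℤ × (evU k).obj Z × (evV k).obj Z //
    (LaurentPolynomial.T t.1 : k[T;T⁻¹]) • Z.rU t.2.1 = Z.rV t.2.2}
  obtain ⟨q, hU, hV⟩ := exists_hom_of_free (fun i : I => i.1.1) (Z := Z) (fun i => i.1.2.1)
    (fun i => i.1.2.2) (fun i => i.2)
  refine ⟨_, q, epi_of_ev q ?_ ?_, locallyProjective_free _ _⟩
  · rw [ModuleCat.epi_iff_surjective]
    intro m
    obtain ⟨j, m', h⟩ := Z.isLoc_rV.surj (Z.rU m)
    rw [ιV_X_pow] at h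
    exact ⟨_, hU ⟨(-j, m, m'), h⟩⟩
  · rw [ModuleCat.epi_iff_surjective]
    intro m'
    obtain ⟨j, m, h⟩ := Z.isLoc_rU.surj (Z.rV m')
    refine ⟨_, hV ⟨(-j, m, m'), ?_⟩⟩
    rw [← h, map_pow, ιU, Polynomial.toLaurent_X, LaurentPolynomial.T_pow, mul_one, smul_smul,
      ← LaurentPolynomial.T_add, neg_add_cancel, LaurentPolynomial.T_zero, one_smul]

section Chain

variable {R J A N : Type*} [CommRing R]

/-- The unipotent endomorphism of the free module on `J × List (R × N)` that adds to the basis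
vector at `(j, (b, n) :: l)` the multiple by `b` of the one at `(j, l)`. -/
def chainMap : (J × List (R × N) →₀ R) →ₗ[R] (J × List (R × N) →₀ R) :=
  Finsupp.linearCombination R fun i => match i with
    | (j, []) => Finsupp.single (j, []) 1
    | (j, (b, n) :: l) => Finsupp.single (j, (b, n) :: l) 1 + b • Finsupp.single (j, l) 1

/-- The basis vectors of the inverse of `chainMap`. -/
def chainInvVec (j : J) : List (R × N) → (J × List (R × N) →₀ R)
  | [] => Finsupp.single (j, []) 1
  | (b, n) :: l => Finsupp.single (j, (b, n) :: l) 1 - b • chainInvVec j l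

lemma chainMap_nil (j : J) :
    chainMap (Finsupp.single (j, ([] : List (R × N))) 1) = Finsupp.single (j, []) 1 := by
  simp [chainMap]

lemma chainMap_cons (j : J) (b : R) (n : N) (l : List (R × N)) :
    chainMap (Finsupp.single (j, (b, n) :: l) 1) =
      Finsupp.single (j, (b, n) :: l) 1 + b • Finsupp.single (j, l) 1 := by
  simp [chainMap]

lemma chainMap_chainInvVec (j : J) (l : List (R × N)) :
    chainMap (chainInvVec j l) = Finsupp.single (j, l) 1 := by
  induction l with
  | nil => exact chainMap_nil j
  | cons p l ih =>
    obtain ⟨b, n⟩ := p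
    rw [chainInvVec, map_sub, map_smul, ih, chainMap_cons, add_sub_cancel_right]

/-- The automorphism `chainMap`. -/
def chainEquiv : (J × List (R × N) →₀ R) ≃ₗ[R] (J × List (R × N) →₀ R) :=
  LinearEquiv.ofLinearMap chainMap
    (Finsupp.linearCombination R fun i => chainInvVec i.1 i.2)
    (Finsupp.basisSingleOne.ext fun i => by
      simp [chainMap_chainInvVec])
    (Finsupp.basisSingleOne.ext fun i => by
      obtain ⟨j, _ | ⟨⟨b, n⟩, l⟩⟩ := i
      · simp [chainMap_nil, chainInvVec]
      · simp [chainMap_cons, chainInvVec])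

end Chain

lemma twistAcyclic_of_generators (Y : Qco k) {S : Set ((evB k).obj Y)}
    (hS : ∀ y, y ∈ AddSubgroup.closure S)
    (h : ∀ (n : ℤ), ∀ y ∈ S, ∃ (a : (evU k).obj Y) (b : (evV k).obj Y),
      y = (LaurentPolynomial.T n : k[T;T⁻¹]) • Y.rU a + Y.rV b) : twistAcyclic k Y := fun n y => by
  induction hS y using AddSubgroup.closure_induction with
  | mem y hy => exact h n y hy
  | zero => exact ⟨0, 0, by simp⟩
  | add y z _ _ hy hz =>
    obtain ⟨a, b, rfl⟩ := hy
    obtain ⟨a', b', rfl⟩ := hz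
    exact ⟨a + a', b + b', by rw [map_add, map_add, smul_add]; abel⟩
  | neg y _ hy =>
    obtain ⟨a, b, rfl⟩ := hy
    exact ⟨-a, -b, by rw [map_neg, map_neg, smul_neg, neg_add]⟩

variable (k) in
-- For every generator of the sections over the intersection and every `n`, a basis vector of `Q` is
-- added whose two restrictions exhibit that generator as a sum of the required form. New basis
-- vectors create new generators; indexing by lists carries out all countably many rounds at once.
-- Since `chainMap` is invertible, `Q` remains locally projective.
lemma hasEnoughInjectives :
    CotorsionTheory.HasEnoughInjectives (locallyProjective k) (twistAcyclic k) := by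
  intro Y
  let B := k[T;T⁻¹]
  let I := ((evB k).obj Y × ℤ) × List (B × ℤ)
  -- The degree at which an index is used is the last one adjoined: the head of the list, or the
  -- integer paired with the section of `Y` if the list is empty.
  let d : I → ℤ := fun i => match i with
    | ((_, n), []) => n
    | (_, (_, n) :: _) => n
  let e : (I →₀ B) ≃ₗ[B] (I →₀ B) := chainEquiv
  let θ₀ : (I →₀ B) →ₗ[B] (evB k).obj Y := Finsupp.linearCombination B fun i => match i with
    | ((p, _), []) => p
    | (_, _ :: _) => 0
  let θ : (I →₀ B) →ₗ[B] (evB k).obj Y := θ₀ ∘ₗ (e.symm : (I →₀ B) →ₗ[B] (I →₀ B))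
  let Q : Qco k := free e d
  obtain ⟨i, p, w, hS, -⟩ := exists_shortExact_shear Y Q θ
  refine ⟨shear Y Q θ, Q, i, p, w, hS, ?_, locallyProjective_free e d⟩
  have hU : ∀ j, ∃ a : (evU k).obj (shear Y Q θ), (shear Y Q θ).rU a =
      (e (Finsupp.single j 1), θ₀ (Finsupp.single j 1)) := fun j => by
    refine ⟨(freeU e d j, 0), (shear_rU Y Q θ (freeU e d j) 0).trans
      (Prod.ext (rU_freeU e d j) ?_)⟩
    change Y.rU 0 + θ₀ (e.symm (Q.rU (freeU e d j))) = θ₀ (Finsupp.single j 1)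
    rw [map_zero, zero_add, rU_freeU, e.symm_apply_apply]
  have hV : ∀ j, ∃ b : (evV k).obj (shear Y Q θ), (shear Y Q θ).rV b =
      ((LaurentPolynomial.T (d j) : B) • Finsupp.single j (1 : B), 0) := fun j =>
    ⟨(freeV e d j, 0), (shear_rV Y Q θ (freeV e d j) 0).trans
      (Prod.ext (rV_freeV e d j) (map_zero Y.rV))⟩
  have hT : ∀ n : ℤ, (LaurentPolynomial.T n : B) * LaurentPolynomial.T (-n) = 1 := fun n => by
    rw [← LaurentPolynomial.T_add, add_neg_cancel, LaurentPolynomial.T_zero]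
  let S : Set ((I →₀ B) × (evB k).obj Y) :=
    Set.range (fun y => (0, y)) ∪ Set.range (fun t : I × B => (Finsupp.single t.1 t.2, 0))
  refine twistAcyclic_of_generators _ (S := S) ?_ ?_
  · rintro ⟨(x : I →₀ B), y⟩
    have h1 : ((0, y) : (I →₀ B) × (evB k).obj Y) ∈ AddSubgroup.closure S :=
      AddSubgroup.subset_closure (Or.inl ⟨y, rfl⟩)
    have h2 : ((x, 0) : (I →₀ B) × (evB k).obj Y) ∈ AddSubgroup.closure S := by
      induction x using Finsupp.induction_linear with
      | zero => exact zero_mem _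
      | add f g hf hg => simpa using add_mem hf hg
      | single i b => exact AddSubgroup.subset_closure (Or.inr ⟨(i, b), rfl⟩)
    have h3 := add_mem h2 h1
    rw [Prod.mk_add_mk, add_zero, zero_add] at h3
    exact h3
  · rintro n _ (⟨y, rfl⟩ | ⟨⟨i, b⟩, rfl⟩)
    -- Indices with empty list deal with sections of `Y`: the two restrictions, compared after the
    -- twist, differ only by `xⁿ x⁻ⁿ y`.
    · obtain ⟨a, ha⟩ := hU (((LaurentPolynomial.T (-n) : B) • y, n), [])
      obtain ⟨c, hc⟩ := hV (((LaurentPolynomial.T (-n) : B) • y, n), [])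
      refine ⟨a, -c, ?_⟩
      rw [map_neg, ha, hc]
      refine Prod.ext ?_ ?_
      · have h (j : (evB k).obj Y × ℤ) : (0 : I →₀ B) =
            (LaurentPolynomial.T n : B) • chainMap (Finsupp.single (j, []) (1 : B)) +
              -((LaurentPolynomial.T n : B) • Finsupp.single (j, []) (1 : B)) := by
          rw [chainMap_nil, add_neg_cancel]
        exact h _
      · change y = (LaurentPolynomial.T n : B) • θ₀ (Finsupp.single _ 1) + -0
        rw [Finsupp.linearCombination_single, one_smul, smul_smul, hT, one_smul, neg_zero,
          add_zero]
    · obtain ⟨p, l⟩ := i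
      -- The index with one more entry deals with `b` times the basis vector at `(p, l)`: its own
      -- basis vector cancels and the off-diagonal term of `chainMap` remains.
      obtain ⟨a, ha⟩ := hU (p, (LaurentPolynomial.T (-n) * b, n) :: l)
      obtain ⟨c, hc⟩ := hV (p, (LaurentPolynomial.T (-n) * b, n) :: l)
      refine ⟨a, -c, ?_⟩
      rw [map_neg, ha, hc]
      refine Prod.ext ?_ ?_
      · have h (j : I) (hj : j = (p, (LaurentPolynomial.T (-n) * b, n) :: l)) :
            (Finsupp.single (p, l) b : I →₀ B) =
              (LaurentPolynomial.T n : B) • chainMap (Finsupp.single j (1 : B)) +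
                -((LaurentPolynomial.T n : B) • Finsupp.single j (1 : B)) := by
          rw [hj, chainMap_cons, smul_add, add_neg_cancel_comm, smul_smul, ← mul_assoc, hT,
            one_mul, Finsupp.smul_single, smul_eq_mul, mul_one]
        exact h _ rfl
      · change 0 = (LaurentPolynomial.T n : B) • θ₀ (Finsupp.single _ 1) + -0
        rw [Finsupp.linearCombination_single, smul_zero, smul_zero, neg_zero, add_zero]

end Qco

end

end ProjLine

end FreeSheaves

/-! ### Exactness of the Hom complexes. -/

section HomComplexes

open CategoryTheory CategoryTheory.Limits CochainComplex CochainComplex.HomComplex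
open scoped Polynomial LaurentPolynomial

namespace CotorsionTheory

/-- Composing a cocycle with a contraction of the source gives a primitive, up to the sign in the
Leibniz rule. -/
lemma exists_δ_eq_of_contraction {C : Type*} [Category C] [Preadditive C]
    {E Y : CochainComplex C ℤ} {h : Cochain E E (-1)} (hh : δ (-1) 0 h = Cochain.ofHom (𝟙 E))
    {m n : ℤ} (hmn : m + 1 = n) (z : Cochain E Y n) (hz : δ n (n + 1) z = 0) :
    ∃ y : Cochain E Y m, δ m n y = z := by
  refine ⟨n.negOnePow • h.comp z (by lia), ?_⟩
  rw [δ_units_smul, δ_comp h z (by lia) 0 (n + 1) n (by lia) (by lia) rfl, hz, hh,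
    Cochain.comp_zero, zero_add, Cochain.id_comp, smul_smul, Int.units_mul_self, one_smul]

lemma exists_contraction_map {A B : Type*} [Category A] [Abelian A] [Category B] [Abelian B]
    (F : A ⥤ B) [F.Additive] [PreservesFiniteLimits F] [PreservesFiniteColimits F]
    {E : CochainComplex A ℤ} (hE : E.Acyclic) (hp : ∀ n, Projective (F.obj (E.cycles n))) :
    ∃ h : Cochain ((F.mapHomologicalComplex _).obj E) ((F.mapHomologicalComplex _).obj E) (-1),
      δ (-1) 0 h = Cochain.ofHom (𝟙 _) :=
  exists_contraction (fun n => ((E.exactAt_iff n).1 (hE n)).map F) fun n =>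
    Projective.of_iso ((E.sc n).mapCyclesIso F).symm (hp n)

end CotorsionTheory

namespace ProjLine

noncomputable section

variable {k : Type u} [Field k]

namespace Qco

variable (k) in
/-- Sections over `U`, on complexes. -/
abbrev chU : CochainComplex (Qco k) ℤ ⥤ CochainComplex (ModuleCat.{u} k[X]) ℤ :=
  (evU k).mapHomologicalComplex _

variable (k) in
/-- Sections over `V`, on complexes. -/
abbrev chV : CochainComplex (Qco k) ℤ ⥤ CochainComplex (ModuleCat.{u} k[X]) ℤ :=
  (evV k).mapHomologicalComplex _

variable (k) in
/-- Sections over `U ∩ V`, on complexes. -/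
abbrev chB : CochainComplex (Qco k) ℤ ⥤ CochainComplex (ModuleCat.{u} k[T;T⁻¹]) ℤ :=
  (evB k).mapHomologicalComplex _

lemma locU_units_smul {F G : Qco k} (ε : ℤˣ) (a : (evU k).obj F ⟶ (evU k).obj G) :
    locU (ε • a) = ε • locU a :=
  map_zsmul (AddMonoidHom.mk' _ locU_add) (ε : ℤ) a

lemma locV_units_smul {F G : Qco k} (ε : ℤˣ) (a : (evV k).obj F ⟶ (evV k).obj G) :
    locV (ε • a) = ε • locV a :=
  map_zsmul (AddMonoidHom.mk' _ locV_add) (ε : ℤ) a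

lemma locU_comp_add_comp {F F' G G' : Qco k} (ε : ℤˣ) (g : G' ⟶ G)
    (a : (evU k).obj F ⟶ (evU k).obj G') (f : F ⟶ F') (b : (evU k).obj F' ⟶ (evU k).obj G) :
    locU (a ≫ (evU k).map g + ε • ((evU k).map f ≫ b)) =
      locU a ≫ (evB k).map g + ε • ((evB k).map f ≫ locU b) := by
  rw [locU_add, locU_units_smul, locU_comp, locU_comp, locU_map, locU_map]

lemma locV_comp_add_comp {F F' G G' : Qco k} (ε : ℤˣ) (g : G' ⟶ G)
    (a : (evV k).obj F ⟶ (evV k).obj G') (f : F ⟶ F') (b : (evV k).obj F' ⟶ (evV k).obj G) :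
    locV (a ≫ (evV k).map g + ε • ((evV k).map f ≫ b)) =
      locV a ≫ (evB k).map g + ε • ((evB k).map f ≫ locV b) := by
  rw [locV_add, locV_units_smul, locV_comp, locV_comp, locV_map, locV_map]

variable {E Y : CochainComplex (Qco k) ℤ} {n : ℤ}

/-- The localization of a cochain over `U`. -/
def cochainU (u : Cochain ((chU k).obj E) ((chU k).obj Y) n) :
    Cochain ((chB k).obj E) ((chB k).obj Y) n :=
  Cochain.mk fun p q h => locU (F := E.X p) (G := Y.X q) (u.v p q h)

/-- The localization of a cochain over `V`. -/
def cochainV (u : Cochain ((chV k).obj E) ((chV k).obj Y) n) :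
    Cochain ((chB k).obj E) ((chB k).obj Y) n :=
  Cochain.mk fun p q h => locV (F := E.X p) (G := Y.X q) (u.v p q h)

lemma cochainU_v (u : Cochain ((chU k).obj E) ((chU k).obj Y) n) (p q : ℤ) (h : p + n = q) :
    (cochainU u).v p q h = locU (F := E.X p) (G := Y.X q) (u.v p q h) := Cochain.mk_v _ _ _ _

lemma cochainV_v (u : Cochain ((chV k).obj E) ((chV k).obj Y) n) (p q : ℤ) (h : p + n = q) :
    (cochainV u).v p q h = locV (F := E.X p) (G := Y.X q) (u.v p q h) := Cochain.mk_v _ _ _ _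

lemma δ_cochainU {m : ℤ} (hmn : m + 1 = n) (u : Cochain ((chU k).obj E) ((chU k).obj Y) m) :
    δ m n (cochainU u) = cochainU (δ m n u) := by
  ext p q h : 1
  rw [cochainU_v, δ_v m n hmn _ p q h (q - 1) (p + 1) rfl rfl,
    δ_v m n hmn _ p q h (q - 1) (p + 1) rfl rfl, cochainU_v, cochainU_v]
  exact (locU_comp_add_comp n.negOnePow (Y.d _ _) _ (E.d _ _) _).symm

lemma δ_cochainV {m : ℤ} (hmn : m + 1 = n) (u : Cochain ((chV k).obj E) ((chV k).obj Y) m) :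
    δ m n (cochainV u) = cochainV (δ m n u) := by
  ext p q h : 1
  rw [cochainV_v, δ_v m n hmn _ p q h (q - 1) (p + 1) rfl rfl,
    δ_v m n hmn _ p q h (q - 1) (p + 1) rfl rfl, cochainV_v, cochainV_v]
  exact (locV_comp_add_comp n.negOnePow (Y.d _ _) _ (E.d _ _) _).symm

lemma cochainU_map (z : Cochain E Y n) : cochainU (z.map (evU k)) = z.map (evB k) := by
  ext p q h : 1
  rw [cochainU_v, Cochain.map_v, Cochain.map_v]
  exact locU_map _

lemma cochainV_map (z : Cochain E Y n) : cochainV (z.map (evV k)) = z.map (evB k) := by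
  ext p q h : 1
  rw [cochainV_v, Cochain.map_v, Cochain.map_v]
  exact locV_map _

lemma cochainU_sub (a b : Cochain ((chU k).obj E) ((chU k).obj Y) n) :
    cochainU (a - b) = cochainU a - cochainU b := by
  ext p q h : 1
  rw [Cochain.sub_v, cochainU_v, cochainU_v, cochainU_v, Cochain.sub_v]
  exact locU_sub _ _

lemma cochainV_add (a b : Cochain ((chV k).obj E) ((chV k).obj Y) n) :
    cochainV (a + b) = cochainV a + cochainV b := by
  ext p q h : 1
  rw [Cochain.add_v, cochainV_v, cochainV_v, cochainV_v, Cochain.add_v]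
  exact locV_add _ _

lemma exists_glue_cochain (a : Cochain ((chU k).obj E) ((chU k).obj Y) n)
    (b : Cochain ((chV k).obj E) ((chV k).obj Y) n) (h : cochainU a = cochainV b) :
    ∃ y : Cochain E Y n, y.map (evU k) = a ∧ y.map (evV k) = b := by
  have key : ∀ (p q : ℤ) (hpq : p + n = q), ∃ f : E.X p ⟶ Y.X q,
      (evU k).map f = a.v p q hpq ∧ (evV k).map f = b.v p q hpq := fun p q hpq =>
    exists_glue (F := E.X p) (G := Y.X q) _ _ (by
      rw [← cochainU_v, ← cochainV_v, h])
  choose f hU hV using key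
  exact ⟨Cochain.mk f, by ext p q hpq : 1; rw [Cochain.map_v, Cochain.mk_v, hU],
    by ext p q hpq : 1; rw [Cochain.map_v, Cochain.mk_v, hV]⟩

lemma cochain_ext {y z : Cochain E Y n} (hU : y.map (evU k) = z.map (evU k))
    (hV : y.map (evV k) = z.map (evV k)) : y = z := by
  ext p q h : 1
  refine hom_ext ?_ ?_
  · rw [← Cochain.map_v, hU, Cochain.map_v]
  · rw [← Cochain.map_v, hV, Cochain.map_v]

/-- Mayer–Vietoris: a cocycle has primitives over both charts. They differ on the intersection by a
cocycle, which bounds there; splitting its primitive into a part from `U` and a part from `V`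
adjusts the local primitives so that they glue. -/
lemma acyclic_homComplex (hE : CotorsionTheory.exactWithCyclesIn (locallyProjective k) E)
    (hY : ∀ n, twistAcyclic k (Y.X n)) : (HomComplex E Y).Acyclic := by
  obtain ⟨hE, hp⟩ := hE
  have hp := fun n => (locallyProjective_iff _).1 (hp n)
  have hEX : ∀ n, locallyProjective k (E.X n) := fun n => by
    obtain ⟨q, w, -, hS⟩ := CotorsionTheory.exists_shortExact_cycles hE n
    exact locallyProjective_of_shortExact _ _ w hS ((locallyProjective_iff _).2 (hp n))
      ((locallyProjective_iff _).2 (hp (n + 1)))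
  obtain ⟨hU, hhU⟩ := CotorsionTheory.exists_contraction_map (evU k) hE fun n => (hp n).1
  obtain ⟨hV, hhV⟩ := CotorsionTheory.exists_contraction_map (evV k) hE fun n => (hp n).2.2
  obtain ⟨hB, hhB⟩ := CotorsionTheory.exists_contraction_map (evB k) hE fun n => (hp n).2.1
  rw [CotorsionTheory.homComplex_acyclic_iff]
  intro m n hmn z hz
  obtain ⟨a, ha⟩ := CotorsionTheory.exists_δ_eq_of_contraction hhU hmn (z.map (evU k))
    (by rw [δ_map, hz, Cochain.map_zero])
  obtain ⟨b, hb⟩ := CotorsionTheory.exists_δ_eq_of_contraction hhV hmn (z.map (evV k))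
    (by rw [δ_map, hz, Cochain.map_zero])
  obtain ⟨w, hw⟩ := CotorsionTheory.exists_δ_eq_of_contraction hhB (sub_add_cancel m 1)
    (cochainU a - cochainV b) (by
      subst hmn
      rw [δ_sub, δ_cochainU rfl, δ_cochainV rfl, ha, hb, cochainU_map, cochainV_map, sub_self])
  have key : ∀ (p q : ℤ) (h : p + (m - 1) = q), ∃ (c : (evU k).obj (E.X p) ⟶ (evU k).obj (Y.X q))
      (d : (evV k).obj (E.X p) ⟶ (evV k).obj (Y.X q)), w.v p q h = locU c + locV d :=
    fun p q h => exists_locU_add_locV (hEX p) (hY q) _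
  choose c d hcd using key
  obtain ⟨c', hc'⟩ : ∃ c' : Cochain ((chU k).obj E) ((chU k).obj Y) (m - 1),
      ∀ p q h, c'.v p q h = c p q h := ⟨Cochain.mk c, fun _ _ _ => Cochain.mk_v _ _ _ _⟩
  obtain ⟨d', hd'⟩ : ∃ d' : Cochain ((chV k).obj E) ((chV k).obj Y) (m - 1),
      ∀ p q h, d'.v p q h = d p q h := ⟨Cochain.mk d, fun _ _ _ => Cochain.mk_v _ _ _ _⟩
  have hwcd : w = cochainU c' + cochainV d' := by
    ext p q h : 1
    rw [Cochain.add_v, cochainU_v, cochainV_v]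
    exact (hcd p q h).trans (congrArg₂ (fun a b => locU a + locV b) (hc' p q h).symm
      (hd' p q h).symm)
  -- Subtracting and adding coboundaries leaves `δ a` and `δ b` unchanged, while the difference on
  -- the intersection becomes `δ w - δ w = 0`.
  obtain ⟨y, h1, h2⟩ := exists_glue_cochain (a - δ (m - 1) m c') (b + δ (m - 1) m d') (by
    rw [cochainU_sub, cochainV_add, ← δ_cochainU (sub_add_cancel m 1),
      ← δ_cochainV (sub_add_cancel m 1),
      sub_eq_iff_eq_add, add_assoc, ← δ_add, add_comm (cochainV d'), ← hwcd, hw]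
    abel)
  refine ⟨y, cochain_ext ?_ ?_⟩
  · rw [← δ_map, h1, δ_sub, ha, δ_δ, sub_zero]
  · rw [← δ_map, h2, δ_add, hb, δ_δ, add_zero]

end Qco

end

end ProjLine

end HomComplexes

theorem mainTheorem8 (k : Type u) [Field k] :
    CotorsionTheory.IsCompleteCotorsionPair
      (CotorsionTheory.exactWithCyclesIn (ProjLine.locallyProjective k))
      (CotorsionTheory.dgRight (ProjLine.locallyProjective k) (ProjLine.twistPerp k)) ∧
    CotorsionTheory.IsCogeneratedBySet.{u}
      (CotorsionTheory.exactWithCyclesIn (ProjLine.locallyProjective k))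
      (CotorsionTheory.dgRight (ProjLine.locallyProjective k) (ProjLine.twistPerp k)) := by
  -- The integers are lifted to the universe in which a small set is required to live.
  have hT : CotorsionTheory.rightPerp (CategoryTheory.ObjectProperty.ofObj
      fun n : ULift.{u} ℤ => ProjLine.twist k n.down) = ProjLine.twistPerp k := by
    refine congrArg CotorsionTheory.rightPerp (funext fun F => propext ⟨?_, ?_⟩)
    · rintro ⟨n⟩
      exact CategoryTheory.ObjectProperty.ofObj_apply _ n.down
    · rintro ⟨n⟩
      exact CategoryTheory.ObjectProperty.ofObj_apply
        (fun n : ULift.{u} ℤ => ProjLine.twist k n.down) ⟨n⟩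
  rw [ProjLine.Qco.twistPerp_eq] at hT ⊢
  exact CotorsionTheory.isCompleteCotorsionPair_exactWithCyclesIn_dgRight
    (ℱ := ProjLine.locallyProjective k) (𝒞 := ProjLine.Qco.twistAcyclic k)
    (fun F C hF hC => ProjLine.Qco.extOneVanishes_of_twistAcyclic (V := F) (Y := C) hF hC)
    (ProjLine.Qco.hasEnoughInjectives k) ProjLine.Qco.exists_epi_locallyProjective
    (fun {C D} p _ hC => ProjLine.Qco.twistAcyclic_of_epi (Y := C) (Z := D) p hC)
    (fun C D hC hD => ProjLine.Qco.twistAcyclic_biprod (Y := C) (Z := D) hC hD)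
    (fun {X Y Z} f g w h hX hZ =>
      ProjLine.Qco.locallyProjective_of_shortExact (F := X) (G := Y) (H := Z) f g w h hX hZ)
    (fun {X Y} i r h hY => ProjLine.Qco.locallyProjective_of_retract (F := X) (G := Y) i r h hY)
    (fun E Y hE hY => ProjLine.Qco.acyclic_homComplex (E := E) (Y := Y) hE hY)
    (fun n : ULift.{u} ℤ => ProjLine.twist k n.down)
    (fun n => ProjLine.Qco.locallyProjective_twist k n.down) hT
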